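/- **Theorem (propagation of chaos for the quantum Kac model).** *Setting.* Let $\mathcal H$ be a separable complex Hilbert space and let $h$ be a self-adjoint operator on $\mathcal H$ with compact resolvent. Write $\mathcal H_N=\mathcal H^{\otimes N}$ (Hilbert space tensor product), $\mathscr B(\mathcal H_N)$ for the bounded operators on $\mathcal H_N$, $H_N=\sum_{j=1}^N h_j$ where $h_j$ is $h$ acting on the $j$-th factor, and $P_E$ for the orthogonal projection onto the eigenspace of $H_2$ with eigenvalue $E$. A *collision specification* $(\mathcal C,U,\nu)$ consists of a compact metric space $\mathcal C$, an injective map $U$ from $\mathcal C$ to the unitary operators on $\mathcal H_2$ that is continuous in operator norm, and a Borel probability measure $\nu$ on $\mathcal C$ that charges every nonempty open set, such that 1. each $U(\sigma)$ commutes with $H_2$; 2. $U(\sigma_0)=1$ for some $\sigma_0\in\mathcal C$; 3. for every $\sigma$ there is $\sigma'$ with $U(\sigma)^*=U(\sigma')$, and the map $\sigma\mapsto\sigma'$ is measurable and leaves $\nu$ invariant; 4. for every $\sigma$ there is $\sigma'$ with $VU(\sigma)V^*=U(\sigma')$, where $V(\phi\otimes\psi)=\psi\otimes\phi$, and the map $\sigma\mapsto\sigma'$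 is measurable and leaves $\nu$ invariant. It is *ergodic* if the commutant of $\{U(\sigma):\sigma\in\mathcal C\}$ in $\mathscr B(\mathcal H_2)$ is the set of all bounded operators of the form $\sum_E\lambda_E P_E$ with $\lambda_E\in\mathbb C$ (the sum converging strongly). For $N\ge 2$ and $i<j$ let $U_{i,j}(\sigma)$ be $U(\sigma)$ acting on the $i$-th and $j$-th factors of $\mathcal H_N$, and on $\mathscr B(\mathcal H_N)$ put $$\mathscr Q_{i,j}A=\int_{\mathcal C}U_{i,j}(\sigma)\,A\,U_{i,j}(\sigma)^*\,d\nu(\sigma),\qquad \mathscr Q_N=\binom N2^{-1}\sum_{i<j}\mathscr Q_{i,j},\qquad \mathscr L_N=N(\mathscr Q_N-1),\qquad \mathscr P_{N,t}=e^{t\mathscr L_N}.$$ A density matrix is a positive operator of trace $1$. A density matrix on $\mathcal H_N$ is *symmetric* if it is invariant under conjugation by all permutations of the $N$ factors, and $\varrho^{(k)}$ denotes its partial trace over the last $N-k$ factors. Given a density matrix $\rho$ on $\mathcal H$, a sequence $\{\varrho_N\}_{N\ge2}$ of symmetric density matrices on $\mathcal H_N$ is *$\rho$-chaotic* if $\lim_{N\to\infty}\varrho_N^{(k)}=\rho^{\otimes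 k}$ in trace norm for every $k\ge1$. *Statement.* Let $(\mathcal C,U,\nu)$ be an ergodic collision specification, let $\rho$ be a density matrix on $\mathcal H$, and let $\{\varrho_N\}_{N\ge2}$ be $\rho$-chaotic. Then for every $t\ge0$ the limit $$\rho(t)=\lim_{N\to\infty}(\mathscr P_{N,t}\varrho_N)^{(1)}$$ exists in trace norm and is a density matrix on $\mathcal H$, and the sequence $\{\mathscr P_{N,t}\varrho_N\}_{N\ge2}$ is $\rho(t)$-chaotic. -/

import Mathlib

open MeasureTheory Filter Topology
open scoped InnerProductSpace

noncomputable section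

namespace QKac

/-! ### Square-summable families and the tensor powers of a Hilbert space

Relative to an orthonormal basis `b : HilbertBasis ι ℂ H`, the Hilbert tensor power `H ⊗ ⋯ ⊗ H`
(`N` factors) is realised as `ℓ²(ι ^ N)`: the elementary tensor `φ₁ ⊗ ⋯ ⊗ φ_N` is the family
`α ↦ ∏ i, ⟪b (α i), φ i⟫`. -/

/-- The Hilbert space `ℓ²(X)`. -/
def L2 (X : Type*) : Type _ := lp (fun _ : X => ℂ) 2

namespace L2

variable {X : Type*}

instance : NormedAddCommGroup (L2 X) :=
  inferInstanceAs (NormedAddCommGroup (lp (fun _ : X => ℂ) 2))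

instance : InnerProductSpace ℂ (L2 X) :=
  inferInstanceAs (InnerProductSpace ℂ (lp (fun _ : X => ℂ) 2))

instance : CompleteSpace (L2 X) := inferInstanceAs (CompleteSpace (lp (fun _ : X => ℂ) 2))

/-- The family underlying an element of `ℓ²(X)`. -/
def val (x : L2 X) : X → ℂ := x.1

instance : CoeFun (L2 X) fun _ => X → ℂ := ⟨val⟩

/-- The element of `ℓ²(X)` given by a square-summable family. -/
def mk (f : X → ℂ) (hf : Summable fun i => ‖f i‖ ^ 2) : L2 X :=
  ⟨f, by
    have : Memℓp f 2 := by
      rw [memℓp_gen_iff (by simp)]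
      simpa using hf
    exact this⟩

@[simp] theorem mk_apply (f : X → ℂ) (hf : Summable fun i => ‖f i‖ ^ 2) (i : X) :
    mk f hf i = f i := rfl

@[simp] theorem add_apply (x y : L2 X) (i : X) : (x + y) i = x i + y i := rfl

@[simp] theorem smul_apply (c : ℂ) (x : L2 X) (i : X) : (c • x) i = c * x i := rfl

@[ext] theorem ext {x y : L2 X} (h : ∀ i, x i = y i) : x = y := Subtype.ext (funext h)

theorem summable_sq (x : L2 X) : Summable fun i => ‖x i‖ ^ 2 := by
  have h : Memℓp x.val 2 := x.2
  rw [memℓp_gen_iff (by simp)] at h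
  simpa using h

theorem norm_sq_eq (x : L2 X) : ‖x‖ ^ 2 = ∑' i, ‖x i‖ ^ 2 := by
  have h : ‖x‖ ^ (2 : ENNReal).toReal = ∑' i, ‖x i‖ ^ (2 : ENNReal).toReal :=
    lp.norm_rpow_eq_tsum (p := 2) (by simp) (show lp (fun _ : X => ℂ) 2 from x)
  simpa using h

end L2

open L2

/-- The bounded operators on `ℓ²(X)`. -/
abbrev Op (X : Type*) := L2 X →L[ℂ] L2 X

/-- The bounded operators on the `N`-particle space `ℓ²(ι ^ N)`. -/
abbrev NOp (ι : Type*) (N : ℕ) := Op (Fin N → ι)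

/-- The canonical orthonormal basis of `ℓ²(X)`. -/
def stdBasis (X : Type*) : HilbertBasis X ℂ (L2 X) := HilbertBasis.ofRepr (.refl ℂ _)

/-- The coordinates `φ ↦ (⟪b i, φ⟫)_i` with respect to an orthonormal basis. -/
def coords {H : Type*} [NormedAddCommGroup H] [InnerProductSpace ℂ H] {ι : Type*}
    (b : HilbertBasis ι ℂ H) : H ≃ₗᵢ[ℂ] L2 ι := b.repr

theorem coords_apply {H : Type*} [NormedAddCommGroup H] [InnerProductSpace ℂ H] {ι : Type*}
    (b : HilbertBasis ι ℂ H) (φ : H) (i : ι) : coords b φ i = ⟪b i, φ⟫_ℂ :=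
  b.repr_apply_apply φ i

theorem summable_pi_prod {ι : Type*} {n : ℕ} (g : Fin n → ι → ℝ) (hg : ∀ i a, 0 ≤ g i a)
    (hs : ∀ i, Summable (g i)) : Summable fun α : Fin n → ι => ∏ i, g i (α i) := by
  induction n with
  | zero => exact Summable.of_finite
  | succ n ih =>
    rw [← (Fin.consEquiv fun _ => ι).summable_iff]
    have := (hs 0).mul_of_nonneg (ih (fun i => g i.succ) (fun i => hg _) (fun i => hs _))
      (hg 0) (fun α => Finset.prod_nonneg fun i _ => hg _ _)
    refine this.congr fun p => ?_
    simp [Fin.consEquiv, Fin.prod_univ_succ]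

/-- The elementary tensor `φ₁ ⊗ ⋯ ⊗ φ_N`. -/
def tprod {H : Type*} [NormedAddCommGroup H] [InnerProductSpace ℂ H] {ι : Type*}
    (b : HilbertBasis ι ℂ H) {N : ℕ} (φ : Fin N → H) : L2 (Fin N → ι) :=
  L2.mk (fun α => ∏ i, ⟪b (α i), φ i⟫_ℂ) <| by
    have := summable_pi_prod (fun i a => ‖coords b (φ i) a‖ ^ 2) (fun _ _ => by positivity)
      (fun i => summable_sq _)
    refine this.congr fun α => ?_
    simp [← Finset.prod_pow, coords_apply]

theorem hasSum_mul {X Y : Type*} {f : X → ℂ} {g : Y → ℂ} {s t : ℂ} (hf : HasSum f s)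
    (hg : HasSum g t) : HasSum (fun p : X × Y => f p.1 * g p.2) (s * t) := by
  have hs : Summable fun p : X × Y => f p.1 * g p.2 := by
    apply summable_mul_of_summable_norm hf.summable.norm hg.summable.norm
  exact hf.mul hg hs

/-- The elementary tensors have the inner products of the Hilbert tensor product. -/
theorem inner_tprod {H : Type*} [NormedAddCommGroup H] [InnerProductSpace ℂ H] {ι : Type*}
    (b : HilbertBasis ι ℂ H) {N : ℕ} (φ ψ : Fin N → H) :
    ⟪tprod b φ, tprod b ψ⟫_ℂ = ∏ i, ⟪φ i, ψ i⟫_ℂ := by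
  have key : ∀ (n : ℕ) (φ ψ : Fin n → H),
      HasSum (fun α : Fin n → ι => ∏ i, ⟪φ i, b (α i)⟫_ℂ * ⟪b (α i), ψ i⟫_ℂ)
        (∏ i, ⟪φ i, ψ i⟫_ℂ) := by
    intro n
    induction n with
    | zero =>
      intro φ ψ
      simp
    | succ n ih =>
      intro φ ψ
      rw [← (Fin.consEquiv fun _ => ι).hasSum_iff, Fin.prod_univ_succ]
      have h2 := hasSum_mul (b.hasSum_inner_mul_inner (φ 0) (ψ 0))
        (ih (fun i => φ i.succ) (fun i => ψ i.succ))
      have h3 : (fun α : Fin (n + 1) → ι => ∏ i, ⟪φ i, b (α i)⟫_ℂ * ⟪b (α i), ψ i⟫_ℂ) ∘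
          (Fin.consEquiv fun _ => ι) = fun p : ι × (Fin n → ι) =>
          (⟪φ 0, b p.1⟫_ℂ * ⟪b p.1, ψ 0⟫_ℂ) *
          ∏ i, ⟪φ (Fin.succ i), b (p.2 i)⟫_ℂ * ⟪b (p.2 i), ψ (Fin.succ i)⟫_ℂ := by
        funext p
        simp [Fin.consEquiv, Fin.prod_univ_succ]
      rw [h3]
      exact h2
  have hs : HasSum (fun α => ⟪(tprod b φ) α, (tprod b ψ) α⟫_ℂ) ⟪tprod b φ, tprod b ψ⟫_ℂ :=
    lp.hasSum_inner (𝕜 := ℂ) (G := fun _ : Fin N → ι => ℂ) (tprod b φ) (tprod b ψ)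
  refine hs.unique ?_
  convert key N φ ψ using 2 with α
  simp [tprod, ← Finset.prod_mul_distrib, mul_comm]

/-- The canonical basis vectors are the elementary tensors of basis vectors. -/
theorem stdBasis_eq {H : Type*} [NormedAddCommGroup H] [InnerProductSpace ℂ H] {ι : Type*}
    (b : HilbertBasis ι ℂ H) {N : ℕ} (α : Fin N → ι) :
    stdBasis (Fin N → ι) α = tprod b fun i => b (α i) := by
  classical
  ext β
  have h1 : (stdBasis (Fin N → ι) α).val β = if β = α then 1 else 0 := by
    have : stdBasis (Fin N → ι) α = lp.single 2 α (1 : ℂ) :=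
      ((stdBasis (Fin N → ι)).repr_symm_single α).symm
    rw [this]
    change (lp.single (E := fun _ : Fin N → ι => ℂ) 2 α (1 : ℂ) : _) β = _
    simp [Pi.single_apply]
  rw [h1]
  simp only [tprod, mk_apply, orthonormal_iff_ite.1 b.orthonormal]
  split_ifs with h
  · simp [h]
  · obtain ⟨i, hi⟩ := Function.ne_iff.1 h
    exact (Finset.prod_eq_zero (Finset.mem_univ i) (by simp [hi])).symm

/-- Re-indexing of families along a bijection, `x ↦ x ∘ e`. -/
def reindex {X Y : Type*} (e : X ≃ Y) : L2 Y ≃ₗᵢ[ℂ] L2 X where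
  toFun x := L2.mk (fun a => x (e a)) ((e.summable_iff (f := fun i => ‖x i‖ ^ 2)).2
    (summable_sq x))
  invFun x := L2.mk (fun a => x (e.symm a))
    ((e.symm.summable_iff (f := fun i => ‖x i‖ ^ 2)).2 (summable_sq x))
  map_add' _ _ := rfl
  map_smul' _ _ := rfl
  left_inv x := by ext a; simp
  right_inv x := by ext a; simp
  norm_map' x := by
    refine (sq_eq_sq₀ (norm_nonneg _) (norm_nonneg _)).1 ?_
    rw [norm_sq_eq, norm_sq_eq]
    exact e.tsum_eq (fun i => ‖x i‖ ^ 2)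

@[simp] theorem reindex_apply {X Y : Type*} (e : X ≃ Y) (x : L2 Y) (a : X) :
    reindex e x a = x (e a) := rfl

@[simp] theorem reindex_symm_apply {X Y : Type*} (e : X ≃ Y) (x : L2 X) (a : Y) :
    (reindex e).symm x a = x (e.symm a) := rfl

/-- Transport of an operator along a bijection of index sets. -/
def transport {X Y : Type*} (e : X ≃ Y) (A : Op Y) : Op X :=
  (reindex e : L2 Y →L[ℂ] L2 X) ∘L A ∘L ((reindex e).symm : L2 X →L[ℂ] L2 Y)

theorem summable_slice {X Y : Type*} (x : L2 (X × Y)) (y : Y) :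
    Summable fun a => ‖x (a, y)‖ ^ 2 :=
  (summable_sq x).comp_injective (i := fun a : X => (a, y)) fun _ _ h => (Prod.ext_iff.1 h).1

/-- The slice `x ↦ x (·, y)`, that is, the contraction `1 ⊗ ⟨e_y|` from `ℓ²(X) ⊗ ℓ²(Y)`
to `ℓ²(X)`. Its adjoint is `φ ↦ φ ⊗ e_y`. -/
def slice (X : Type*) {Y : Type*} (y : Y) : L2 (X × Y) →L[ℂ] L2 X :=
  LinearMap.mkContinuous
    { toFun := fun x => L2.mk (fun a => x (a, y)) (summable_slice x y)
      map_add' := fun _ _ => rfl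
      map_smul' := fun _ _ => rfl } 1 fun x => by
    rw [one_mul]
    refine (sq_le_sq₀ (norm_nonneg _) (norm_nonneg _)).1 ?_
    rw [norm_sq_eq, norm_sq_eq]
    exact tsum_comp_le_tsum_of_inj (summable_sq x) (fun _ => by positivity)
      (i := fun a : X => (a, y)) fun _ _ h => (Prod.ext_iff.1 h).1

@[simp] theorem slice_apply {X Y : Type*} (y : Y) (x : L2 (X × Y)) (a : X) :
    slice X y x a = x (a, y) := rfl

theorem hasSum_norm_slice {X Y : Type*} (x : L2 (X × Y)) :
    HasSum (fun y => ‖slice X y x‖ ^ 2) (‖x‖ ^ 2) := by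
  have hs : Summable fun p : Y × X => ‖x p.swap‖ ^ 2 :=
    ((Equiv.prodComm Y X).summable_iff (f := fun i => ‖x i‖ ^ 2)).2 (summable_sq x)
  have h1 := hs.hasSum.prod_fiberwise (fun y => (hs.prod_factor y).hasSum)
  have h2 : ∑' p : Y × X, ‖x p.swap‖ ^ 2 = ‖x‖ ^ 2 := by
    rw [norm_sq_eq]; exact (Equiv.prodComm Y X).tsum_eq (fun i => ‖x i‖ ^ 2)
  rw [h2] at h1
  have h3 : (fun y => ‖slice X y x‖ ^ 2) = fun y => ∑' a, ‖x (a, y)‖ ^ 2 := by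
    funext y; rw [norm_sq_eq]; rfl
  rw [h3]
  exact h1

theorem hasSum_tensorOne {X Y : Type*} (A : Op X) (x : L2 (X × Y)) :
    Summable (fun p : X × Y => ‖A (slice X p.2 x) p.1‖ ^ 2) ∧
      ∑' p : X × Y, ‖A (slice X p.2 x) p.1‖ ^ 2 ≤ ‖A‖ ^ 2 * ‖x‖ ^ 2 := by
  have hle : ∀ y, ‖A (slice X y x)‖ ^ 2 ≤ ‖A‖ ^ 2 * ‖slice X y x‖ ^ 2 := fun y => by
    rw [← mul_pow]
    exact pow_le_pow_left₀ (norm_nonneg _) (A.le_opNorm _) 2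
  have hs : HasSum (fun y => ‖A‖ ^ 2 * ‖slice X y x‖ ^ 2) (‖A‖ ^ 2 * ‖x‖ ^ 2) :=
    (hasSum_norm_slice x).mul_left (‖A‖ ^ 2)
  have hs' : Summable fun y => ‖A (slice X y x)‖ ^ 2 :=
    Summable.of_nonneg_of_le (fun _ => by positivity) hle hs.summable
  have h1 : (fun y => ∑' a, ‖A (slice X y x) a‖ ^ 2) = fun y => ‖A (slice X y x)‖ ^ 2 :=
    funext fun y => (norm_sq_eq _).symm
  have hsw : Summable fun p : Y × X => ‖A (slice X p.1 x) p.2‖ ^ 2 := by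
    rw [summable_prod_of_nonneg (fun _ => by positivity)]
    refine ⟨fun y => summable_sq (A (slice X y x)), ?_⟩
    rw [← h1] at hs'
    exact hs'
  refine ⟨((Equiv.prodComm Y X).summable_iff
    (f := fun p : X × Y => ‖A (slice X p.2 x) p.1‖ ^ 2)).1 hsw, ?_⟩
  calc ∑' p : X × Y, ‖A (slice X p.2 x) p.1‖ ^ 2
      = ∑' p : Y × X, ‖A (slice X p.1 x) p.2‖ ^ 2 := by
        exact ((Equiv.prodComm Y X).tsum_eq
          (fun p : X × Y => ‖A (slice X p.2 x) p.1‖ ^ 2)).symm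
    _ = ∑' y, ‖A (slice X y x)‖ ^ 2 := by
        exact hsw.tsum_prod.trans (congrArg tsum h1)
    _ ≤ _ := hasSum_le hle hs'.hasSum hs

/-- The operator `A ⊗ 1` on `ℓ²(X) ⊗ ℓ²(Y) = ℓ²(X × Y)`: `A` acts on every slice. -/
def tensorOne {X : Type*} (Y : Type*) (A : Op X) : Op (X × Y) :=
  LinearMap.mkContinuous
    { toFun := fun x => L2.mk (fun p => A (slice X p.2 x) p.1) (hasSum_tensorOne A x).1
      map_add' := fun x y => by ext p; simp
      map_smul' := fun c x => by ext p; simp } ‖A‖ fun x => by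
    refine (sq_le_sq₀ (norm_nonneg _) (by positivity)).1 ?_
    rw [norm_sq_eq, mul_pow]
    exact (hasSum_tensorOne A x).2

@[simp] theorem tensorOne_apply {X Y : Type*} (A : Op X) (x : L2 (X × Y)) (p : X × Y) :
    tensorOne Y A x p = A (slice X p.2 x) p.1 := rfl

/-- The tensor product `A ⊗ B` of two operators. -/
def tensorOp {X Y : Type*} (A : Op X) (B : Op Y) : Op (X × Y) :=
  tensorOne Y A * transport (Equiv.prodComm X Y) (tensorOne X B)

/-- The tensor power `ρ ⊗ ⋯ ⊗ ρ` (`k` factors) of an operator on `H`. -/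
def tensorPow {H : Type*} [NormedAddCommGroup H] [InnerProductSpace ℂ H] {ι : Type*}
    (b : HilbertBasis ι ℂ H) (ρ : H →L[ℂ] H) : (k : ℕ) → NOp ι k
  | 0 => 1
  | k + 1 => transport (Fin.consEquiv fun _ => ι).symm
      (tensorOp ((coords b : H →L[ℂ] L2 ι) ∘L ρ ∘L ((coords b).symm : L2 ι →L[ℂ] H))
        (tensorPow b ρ k))

/-- The partial trace over the second factor of `ℓ²(X) ⊗ ℓ²(Y)`,
`Tr_Y A = ∑ y, (1 ⊗ ⟨e_y|) A (1 ⊗ |e_y⟩)`. For trace class `A` the series converges absolutely in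
operator norm. -/
def partialTrace {X Y : Type*} (A : Op (X × Y)) : Op X :=
  ∑' y, slice X y ∘L A ∘L (slice X y).adjoint

/-- The `k`-particle reduced operator of an operator on `k + m` particles: the partial trace over
the last `m` factors. -/
def marginal {ι : Type*} (k m : ℕ) (A : NOp ι (k + m)) : NOp ι k :=
  partialTrace (transport (Fin.appendEquiv k m) A)

/-! ### Density matrices -/

/-- Density matrices: positive operators with trace `1`; the trace of a positive operator does not
depend on the orthonormal basis `b` used to compute it. -/
def IsDensityMatrix {K : Type*} [NormedAddCommGroup K] [InnerProductSpace ℂ K] [CompleteSpace K]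
    {X : Type*} (b : HilbertBasis X ℂ K) (A : K →L[ℂ] K) : Prop :=
  A.IsPositive ∧ HasSum (fun i => ⟪b i, A (b i)⟫_ℂ) 1

/-- The trace norm `‖A‖₁ = Tr |A|`, where `|A| = (A* A)^(1/2)`, computed in an orthonormal basis
(the value does not depend on it); it is infinite if `A` is not of trace class. -/
def traceNorm {K : Type*} [NormedAddCommGroup K] [InnerProductSpace ℂ K] [CompleteSpace K]
    {X : Type*} (b : HilbertBasis X ℂ K) (A : K →L[ℂ] K) : ENNReal :=
  ∑' i, ENNReal.ofReal (RCLike.re ⟪b i, CFC.abs A (b i)⟫_ℂ)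

/-- The unitary action of a permutation on `N`-particle space,
`φ₁ ⊗ ⋯ ⊗ φ_N ↦ φ_{π 1} ⊗ ⋯ ⊗ φ_{π N}`. -/
def permOp (ι : Type*) {N : ℕ} (π : Equiv.Perm (Fin N)) : NOp ι N :=
  (reindex (Equiv.arrowCongr π (Equiv.refl ι)) : L2 (Fin N → ι) →L[ℂ] L2 (Fin N → ι))

/-- Symmetric density matrices on `N`-particle space. -/
def IsSymmDensityMatrix {ι : Type*} {N : ℕ} (A : NOp ι N) : Prop :=
  IsDensityMatrix (stdBasis _) A ∧ ∀ π : Equiv.Perm (Fin N), permOp ι π * A * star (permOp ι π) = A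

/-- A sequence `ϱ N`, `N ≥ 2`, of symmetric density matrices on the `N`-particle spaces is
`ρ`-chaotic if `ρ` is a density matrix and, for every `k ≥ 1`, the `k`-particle reduced density
matrices of `ϱ N` converge to `ρ ⊗ ⋯ ⊗ ρ` in trace norm as `N = k + m → ∞`. -/
structure IsChaotic {H : Type*} [NormedAddCommGroup H] [InnerProductSpace ℂ H] [CompleteSpace H]
    {ι : Type*} (b : HilbertBasis ι ℂ H) (ρ : H →L[ℂ] H) (ϱ : (N : ℕ) → NOp ι N) : Prop where
  density : IsDensityMatrix b ρ
  symm_density : ∀ N, 2 ≤ N → IsSymmDensityMatrix (ϱ N)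
  tendsto : ∀ k, 1 ≤ k →
    Tendsto (fun m => traceNorm (stdBasis _) (marginal k m (ϱ (k + m)) - tensorPow b ρ k))
      atTop (𝓝 0)

/-! ### Hamiltonians -/

section Hamiltonian

variable {H : Type*} [NormedAddCommGroup H] [InnerProductSpace ℂ H] {ι : Type*}

/-- The operator `h` has a compact resolvent: for some `z`, the operator `h - z` has a bounded
everywhere defined inverse, which is compact. -/
def HasCompactResolvent (h : H →ₗ.[ℂ] H) : Prop :=
  ∃ (z : ℂ) (R : H →L[ℂ] H), IsCompactOperator R ∧
    (∀ x : h.domain, R (h x - z • (x : H)) = x) ∧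
    ∀ y : H, ∃ x : h.domain, (x : H) = R y ∧ h x - z • (x : H) = y

/-- The graph of the `N`-particle Hamiltonian `H_N = ∑ j, h_j`, where `h_j` is `h` acting on the
`j`-th factor: the closure of its graph on the span of elementary tensors. -/
def hamGraph (b : HilbertBasis ι ℂ H) (h : H →ₗ.[ℂ] H) (N : ℕ) :
    Submodule ℂ (L2 (Fin N → ι) × L2 (Fin N → ι)) :=
  (Submodule.span ℂ (Set.range fun φ : Fin N → h.domain =>
    (tprod b fun i => (φ i : H),
      ∑ j, tprod b (Function.update (fun i => (φ i : H)) j (h (φ j)))))).topologicalClosure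

/-- The energy algebra of the `N`-particle Hamiltonian: the bounded operators `∑ E, f E • P_E`,
where `P_E` is the projection onto the eigenspace of `H_N` with eigenvalue `E`. -/
def energyAlgebra (b : HilbertBasis ι ℂ H) (h : H →ₗ.[ℂ] H) (N : ℕ) : Set (NOp ι N) :=
  {A | ∃ f : ℝ → ℂ, ∀ (E : ℝ) (x : L2 (Fin N → ι)),
    (x, (E : ℂ) • x) ∈ hamGraph b h N → A x = f E • x}

end Hamiltonian

/-! ### Collision specifications -/

/-- A collision specification `(C, U, ν)` for the one-particle Hamiltonian `h`. -/
structure CollisionSpec {H : Type*} [NormedAddCommGroup H] [InnerProductSpace ℂ H] {ι : Type*}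
    (b : HilbertBasis ι ℂ H) (h : H →ₗ.[ℂ] H)
    (C : Type*) [MetricSpace C] [CompactSpace C] [MeasurableSpace C] [BorelSpace C] where
  /-- the unitary operators on two-particle space that describe the collisions -/
  U : C → unitary (NOp ι 2)
  continuous_U : Continuous U
  injective_U : Function.Injective U
  /-- the distribution of the collision parameter -/
  ν : Measure C
  isProbabilityMeasure : IsProbabilityMeasure ν
  isOpenPosMeasure : ν.IsOpenPosMeasure
  /-- `U σ` commutes with the two-particle Hamiltonian: `U σ H₂ (U σ)* = H₂` -/
  energy_conserved : ∀ (σ : C) (x y : L2 (Fin 2 → ι)),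
    (x, y) ∈ hamGraph b h 2 ↔ ((U σ : NOp ι 2) x, (U σ : NOp ι 2) y) ∈ hamGraph b h 2
  exists_eq_one : ∃ σ₀, U σ₀ = 1
  time_reversal : ∃ T : C → C, MeasurePreserving T ν ν ∧ ∀ σ, star (U σ) = U (T σ)
  swap_invariant : ∃ T : C → C, MeasurePreserving T ν ν ∧ ∀ σ,
    permOp ι (Equiv.swap (0 : Fin 2) 1) * (U σ : NOp ι 2) * star (permOp ι (Equiv.swap (0 : Fin 2) 1))
      = (U (T σ) : NOp ι 2)

/-- The splitting of an `N`-tuple into its entries `i`, `j` and the remaining entries. -/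
def pairSplit (ι : Type*) {N : ℕ} {i j : Fin N} (hij : i ≠ j) :
    (Fin N → ι) ≃ (Fin 2 → ι) × ({l : Fin N // l ≠ i ∧ l ≠ j} → ι) where
  toFun α := (![α i, α j], fun l => α l)
  invFun p l := if hi : l = i then p.1 0 else if hj : l = j then p.1 1 else p.2 ⟨l, hi, hj⟩
  left_inv α := by
    funext l
    by_cases hi : l = i
    · simp [hi]
    · by_cases hj : l = j
      · subst hj; simp [hi]
      · simp [hi, hj]
  right_inv p := by
    refine Prod.ext ?_ ?_
    · funext l
      fin_cases l <;> simp [hij.symm]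
    · funext l
      simp [l.2.1, l.2.2]

/-- The action of a two-particle operator on the factors `i` and `j` of `N`-particle space. -/
def pairOp {ι : Type*} {N : ℕ} {i j : Fin N} (hij : i ≠ j) (A : NOp ι 2) : NOp ι N :=
  transport (pairSplit ι hij) (tensorOne _ A)

theorem tensorOne_sub {X Y : Type*} (A B : Op X) :
    tensorOne Y (A - B) = tensorOne Y A - tensorOne Y B := by
  rw [eq_sub_iff_add_eq]
  ext x p
  simp [tensorOne, ← add_apply]

theorem norm_tensorOne_le {X Y : Type*} (A : Op X) : ‖tensorOne Y A‖ ≤ ‖A‖ :=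
  LinearMap.mkContinuous_norm_le _ (norm_nonneg _) _

theorem norm_transport_le {X Y : Type*} (e : X ≃ Y) (A : Op Y) : ‖transport e A‖ ≤ ‖A‖ := by
  refine ContinuousLinearMap.opNorm_le_bound _ (norm_nonneg _) fun x => ?_
  simp only [transport, ContinuousLinearMap.comp_apply]
  calc _ = ‖A ((reindex e).symm x)‖ := (reindex e).norm_map _
    _ ≤ ‖A‖ * ‖(reindex e).symm x‖ := A.le_opNorm _
    _ = _ := by rw [(reindex e).symm.norm_map]

theorem continuous_pairOp {ι : Type*} {N : ℕ} {i j : Fin N} (hij : i ≠ j) :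
    Continuous fun A : NOp ι 2 => (pairOp hij A : NOp ι N) := by
  refine (LipschitzWith.of_dist_le_mul (K := 1) fun A B => ?_).continuous
  rw [dist_eq_norm, dist_eq_norm, NNReal.coe_one, one_mul]
  have : (pairOp hij A - pairOp hij B : NOp ι N) = pairOp hij (A - B) := by
    simp [pairOp, tensorOne_sub, transport, ContinuousLinearMap.comp_sub,
      ContinuousLinearMap.sub_comp]
  rw [this]
  exact (norm_transport_le _ _).trans (norm_tensorOne_le _)

namespace CollisionSpec

variable {H : Type*} [NormedAddCommGroup H] [InnerProductSpace ℂ H] {ι : Type*}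
  {b : HilbertBasis ι ℂ H} {h : H →ₗ.[ℂ] H}
  {C : Type*} [MetricSpace C] [CompactSpace C] [MeasurableSpace C] [BorelSpace C]

/-- Ergodicity: the commutant of the collision operators is the two-particle energy algebra. -/
def IsErgodic (S : CollisionSpec b h C) : Prop :=
  Set.centralizer (Set.range fun σ => (S.U σ : NOp ι 2)) = energyAlgebra b h 2

/-- The operator `U_{i,j}(σ)` on `N`-particle space. -/
def UPair (S : CollisionSpec b h C) {N : ℕ} {i j : Fin N} (hij : i ≠ j) (σ : C) : NOp ι N :=
  pairOp hij (S.U σ)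

/-- The averaged binary collision `Q_{i,j} = ∫ U_{i,j}(σ) (·) U_{i,j}(σ)* dν(σ)`, as a bounded
operator on the bounded operators on `N`-particle space (see `QPair_apply`). -/
def QPair (S : CollisionSpec b h C) {N : ℕ} {i j : Fin N} (hij : i ≠ j) : NOp ι N →L[ℂ] NOp ι N :=
  ∫ σ, ContinuousLinearMap.mulLeftRight ℂ (NOp ι N) (S.UPair hij σ) (star (S.UPair hij σ)) ∂S.ν

theorem QPair_apply (S : CollisionSpec b h C) {N : ℕ} {i j : Fin N} (hij : i ≠ j) (A : NOp ι N) :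
    Integrable (fun σ => S.UPair hij σ * A * star (S.UPair hij σ)) S.ν ∧
    S.QPair hij A = ∫ σ, S.UPair hij σ * A * star (S.UPair hij σ) ∂S.ν := by
  have := S.isProbabilityMeasure
  have hU : Continuous (S.UPair hij) :=
    (continuous_pairOp hij).comp (continuous_subtype_val.comp S.continuous_U)
  have hc : Continuous fun σ => ContinuousLinearMap.mulLeftRight ℂ (NOp ι N)
      (S.UPair hij σ) (star (S.UPair hij σ)) :=
    (((ContinuousLinearMap.mulLeftRight ℂ (NOp ι N)).continuous.comp hU).clm_apply
      (continuous_star.comp hU))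
  have hi : Integrable (fun σ => ContinuousLinearMap.mulLeftRight ℂ (NOp ι N)
      (S.UPair hij σ) (star (S.UPair hij σ))) S.ν :=
    hc.integrable_of_hasCompactSupport (HasCompactSupport.of_compactSpace _)
  refine ⟨hi.apply_continuousLinearMap A, ?_⟩
  rw [QPair, ContinuousLinearMap.integral_apply hi]
  rfl

/-- `Q_N = (N choose 2)⁻¹ ∑_{i < j} Q_{i,j}`. -/
def QN (S : CollisionSpec b h C) (N : ℕ) : NOp ι N →L[ℂ] NOp ι N :=
  ((N.choose 2 : ℂ))⁻¹ • ∑ p : {p : Fin N × Fin N // p.1 < p.2}, S.QPair p.2.ne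

/-- The quantum Kac generator `L_N = N (Q_N - 1)`. -/
def generator (S : CollisionSpec b h C) (N : ℕ) : NOp ι N →L[ℂ] NOp ι N :=
  (N : ℂ) • (S.QN N - 1)

/-- The quantum Kac semigroup `P_{N,t} = exp (t L_N)`. -/
def semigroup (S : CollisionSpec b h C) (N : ℕ) (t : ℝ) : NOp ι N →L[ℂ] NOp ι N :=
  NormedSpace.exp ((t : ℂ) • S.generator N)

end CollisionSpec

end QKac

end

open QKac

/-!
Convergence of density matrices in trace norm is convergence in norm of the normal functionals
`A ↦ Tr (ϱ A)`. Time reversal invariance makes `P_{N,t}` its own transpose, so that the evolved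
state is the functional `φ_N ∘ P_{N,t}`, and its `k`-particle marginal is expanded in powers of the
generator. Collisions among particles other than the first `k` contribute nothing, collisions among
the first `k` are `O(k² / N)`, and by symmetry the collisions of the first `k` with the others tend
to twice the collisions with one further particle. The `j`-th term of the expansion is bounded by
`2^k (16 t)^j` uniformly in `N`, hence for `16 t < 1` the marginals converge to the sum of the
limiting series (McKean). The collision operator with one further particle satisfies a Leibniz rule,
so that the limit is again a product family. As the admissible times do not depend on the state,
iterating with the semigroup property reaches all times.
-/

set_option maxSynthPendingDepth 3

noncomputable section

namespace QKac

open L2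
open InnerProductSpace (rankOne)

/-! ### Normal functionals -/

section Predual

variable {E F : Type*} [NormedAddCommGroup E] [InnerProductSpace ℂ E]
  [NormedAddCommGroup F] [InnerProductSpace ℂ F]

/-- The bounded functionals on the bounded operators of a Hilbert space. -/
abbrev OpDual (E : Type*) [NormedAddCommGroup E] [InnerProductSpace ℂ E] : Type _ :=
  (E →L[ℂ] E) →L[ℂ] ℂ

/-- The vector functional `B ↦ ⟪x, B y⟫`. -/
def vecFun (x y : E) : OpDual E := innerSL ℂ x ∘L ContinuousLinearMap.apply ℂ E y

@[simp] theorem vecFun_apply (x y : E) (B : E →L[ℂ] E) : vecFun x y B = ⟪x, B y⟫_ℂ := rfl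

theorem norm_vecFun_le (x y : E) : ‖vecFun x y‖ ≤ ‖x‖ * ‖y‖ := by
  refine ContinuousLinearMap.opNorm_le_bound _ (by positivity) fun B => ?_
  calc ‖⟪x, B y⟫_ℂ‖ ≤ ‖x‖ * (‖B‖ * ‖y‖) :=
        (norm_inner_le_norm _ _).trans (by gcongr; exact B.le_opNorm y)
    _ = ‖x‖ * ‖y‖ * ‖B‖ := by ring

/-- The predual of the bounded operators, that is, the space of normal functionals: the norm closure
of the span of the vector functionals. -/
def predual (E : Type*) [NormedAddCommGroup E] [InnerProductSpace ℂ E] : Submodule ℂ (OpDual E) :=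
  (Submodule.span ℂ (Set.range fun p : E × E => vecFun p.1 p.2)).topologicalClosure

theorem isClosed_predual : IsClosed (predual E : Set (OpDual E)) :=
  Submodule.isClosed_topologicalClosure _

theorem vecFun_mem_predual (x y : E) : vecFun x y ∈ predual E :=
  Submodule.le_topologicalClosure _ (Submodule.subset_span ⟨(x, y), rfl⟩)

theorem predual_le {M : Submodule ℂ (OpDual E)} (hM : IsClosed (M : Set (OpDual E)))
    (h : ∀ x y, vecFun x y ∈ M) : predual E ≤ M :=
  Submodule.topologicalClosure_minimal _
    (Submodule.span_le.2 (by rintro _ ⟨p, rfl⟩; exact h _ _)) hM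

theorem mem_predual_of_hasSum {X : Type*} {f : X → OpDual E} {ω : OpDual E} (h : HasSum f ω)
    (hf : ∀ i, f i ∈ predual E) : ω ∈ predual E :=
  isClosed_predual.mem_of_tendsto h
    (Eventually.of_forall fun _ => (predual E).sum_mem fun i _ => hf i)

theorem comp_mem_predual {T : (E →L[ℂ] E) →L[ℂ] (F →L[ℂ] F)}
    (hT : ∀ x y, vecFun x y ∘L T ∈ predual E) {ω : OpDual F} (hω : ω ∈ predual F) :
    ω ∘L T ∈ predual E := by
  let P : OpDual F →L[ℂ] OpDual E := (ContinuousLinearMap.compL ℂ _ _ _).flip T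
  have hclosed : IsClosed (((predual E).comap P.toLinearMap : Submodule ℂ _) : Set (OpDual F)) :=
    isClosed_predual.preimage P.continuous
  exact predual_le hclosed hT hω

theorem tendsto_of_mem_predual {α G : Type*} [NormedAddCommGroup G] [NormedSpace ℂ G]
    {l : Filter α} {T : α → OpDual E →L[ℂ] G} {S : OpDual E →L[ℂ] G} {c : NNReal}
    (hc : ∀ a, ‖T a‖ ≤ c)
    (h : ∀ x y, Tendsto (fun a => T a (vecFun x y)) l (𝓝 (S (vecFun x y))))
    {ω : OpDual E} (hω : ω ∈ predual E) : Tendsto (fun a => T a ω) l (𝓝 (S ω)) := by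
  let M : Submodule ℂ (OpDual E) :=
    { carrier := {ω | Tendsto (fun a => T a ω) l (𝓝 (S ω))}
      add_mem' := fun {η ζ} hη hζ => by
        simp only [Set.mem_ofPred_eq, map_add] at *
        exact hη.add hζ
      zero_mem' := by simp [tendsto_const_nhds]
      smul_mem' := fun z η hη => by
        simp only [Set.mem_ofPred_eq, map_smul] at *
        exact hη.const_smul z }
  have hequi : Equicontinuous fun a η => T a η :=
    (LipschitzWith.uniformEquicontinuous (fun a η => T a η) c fun a =>
      (T a).lipschitz.weaken (hc a)).equicontinuous
  exact predual_le (M := M) (hequi.isClosed_setOfPred_tendsto S.continuous) h hω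

end Predual

section Density

variable {E : Type*} [NormedAddCommGroup E] [InnerProductSpace ℂ E]

theorem op_ext {A B : E →L[ℂ] E} (h : ∀ x y, ⟪x, A y⟫_ℂ = ⟪x, B y⟫_ℂ) : A = B :=
  ContinuousLinearMap.ext fun y => ext_inner_left ℂ fun x => h x y

variable [CompleteSpace E]

/-- The operator underlying `dens`. -/
def densAux (ω : OpDual E) : E →L[ℂ] E :=
  (InnerProductSpace.continuousLinearMapOfBilin (𝕜 := ℂ)
    ((ContinuousLinearMap.compL ℂ E (E →L[ℂ] E) ℂ ω).comp
      (rankOne ℂ : E →L[ℂ] E →L⋆[ℂ] E →L[ℂ] E).flip)).adjoint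

theorem inner_densAux (ω : OpDual E) (x y : E) :
    ⟪x, densAux ω y⟫_ℂ = ω (rankOne ℂ y x) := by
  rw [densAux, ContinuousLinearMap.adjoint_inner_right,
    InnerProductSpace.continuousLinearMapOfBilin_apply]
  rfl

theorem norm_densAux_le (ω : OpDual E) : ‖densAux ω‖ ≤ ‖ω‖ := by
  refine ContinuousLinearMap.opNorm_le_of_re_inner_le (norm_nonneg _) fun y x hy hx => ?_
  calc RCLike.re ⟪densAux ω y, x⟫_ℂ ≤ ‖⟪x, densAux ω y⟫_ℂ‖ := by
        rw [norm_inner_symm]; exact RCLike.re_le_norm _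
    _ = ‖ω (rankOne ℂ y x)‖ := by rw [inner_densAux]
    _ ≤ ‖ω‖ := by simpa [hx, hy] using ω.le_opNorm (rankOne ℂ y x)

/-- The density operator of a functional, determined by `⟪x, dens ω y⟫ = ω (|y⟩⟨x|)`. It determines
the functional only if the latter is normal. -/
def dens : OpDual E →L[ℂ] (E →L[ℂ] E) :=
  LinearMap.mkContinuous
    { toFun := densAux
      map_add' := fun ω η => op_ext fun x y => by simp [inner_densAux]
      map_smul' := fun c ω => op_ext fun x y => by simp [inner_densAux] } 1
    fun ω => (norm_densAux_le ω).trans_eq (one_mul _).symm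

@[simp] theorem inner_dens (ω : OpDual E) (x y : E) :
    ⟪x, dens ω y⟫_ℂ = ω (rankOne ℂ y x) := inner_densAux ω x y

end Density

section Trace

variable {E : Type*} [NormedAddCommGroup E] [InnerProductSpace ℂ E] {X : Type*}
  (b : HilbertBasis X ℂ E)

/-- The orthogonal projection onto the span of finitely many basis vectors. -/
def basisProj (s : Finset X) : E →L[ℂ] E := ∑ i ∈ s, rankOne ℂ (b i) (b i)

theorem inner_basisProj (s : Finset X) (x y : E) :
    ⟪x, basisProj b s y⟫_ℂ = ∑ i ∈ s, ⟪x, b i⟫_ℂ * ⟪b i, y⟫_ℂ := by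
  simp [basisProj, mul_comm]

theorem norm_basisProj_le (s : Finset X) : ‖basisProj b s‖ ≤ 1 := by
  refine ContinuousLinearMap.opNorm_le_bound _ zero_le_one fun y => ?_
  have hsum : basisProj b s y = ∑ i ∈ s, ⟪b i, y⟫_ℂ • b i := by simp [basisProj]
  have hsq : ‖basisProj b s y‖ ^ 2 = ∑ i ∈ s, ‖⟪b i, y⟫_ℂ‖ ^ 2 := by
    rw [hsum, @norm_sq_eq_re_inner ℂ, b.orthonormal.inner_sum, map_sum]
    exact Finset.sum_congr rfl fun i _ => by rw [RCLike.conj_mul]; norm_cast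
  rw [one_mul]
  exact (sq_le_sq₀ (norm_nonneg _) (norm_nonneg _)).1
    (hsq.trans_le (b.orthonormal.sum_inner_products_le y))

theorem re_inner_mono {A B : E →L[ℂ] E} (h : A ≤ B) (x : E) :
    RCLike.re ⟪x, A x⟫_ℂ ≤ RCLike.re ⟪x, B x⟫_ℂ := by
  have := ((ContinuousLinearMap.le_def A B).1 h).re_inner_nonneg_right x
  simpa [inner_sub_right] using this

theorem re_inner_nonneg {A : E →L[ℂ] E} (h : 0 ≤ A) (x : E) : 0 ≤ RCLike.re ⟪x, A x⟫_ℂ := by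
  simpa using re_inner_mono h x

variable [CompleteSpace E]

theorem apply_basisProj_mul (ω : OpDual E) (B : E →L[ℂ] E) (s : Finset X) :
    ω (basisProj b s * B) = ∑ i ∈ s, ⟪b i, B (dens ω (b i))⟫_ℂ := by
  rw [basisProj, Finset.sum_mul, map_sum]
  refine Finset.sum_congr rfl fun i _ => ?_
  rw [← ContinuousLinearMap.adjoint_inner_left, inner_dens]
  exact congrArg ω (InnerProductSpace.rankOne_comp _ _ _)

theorem hasSum_inner_dens {ω : OpDual E} (hω : ω ∈ predual E) (B : E →L[ℂ] E) :
    HasSum (fun i => ⟪b i, B (dens ω (b i))⟫_ℂ) (ω B) := by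
  have hbound : ∀ s, ‖ContinuousLinearMap.apply ℂ ℂ (basisProj b s * B)‖ ≤ ‖B‖₊ := fun s => by
    refine ContinuousLinearMap.opNorm_le_bound _ (norm_nonneg _) fun η => ?_
    have hle : ‖basisProj b s * B‖ ≤ ‖B‖ := (norm_mul_le _ _).trans
      (mul_le_of_le_one_left (norm_nonneg _) (norm_basisProj_le b s))
    exact (η.le_opNorm_of_le hle).trans_eq (mul_comm _ _)
  have hvec : ∀ x y, Tendsto (fun s => ContinuousLinearMap.apply ℂ ℂ (basisProj b s * B)
      (vecFun x y)) atTop (𝓝 (ContinuousLinearMap.apply ℂ ℂ B (vecFun x y))) := fun x y => by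
    simp only [ContinuousLinearMap.apply_apply, vecFun_apply, mul_apply_eq_comp, inner_basisProj]
    simpa only [HasSum, SummationFilter.unconditional_filter] using b.hasSum_inner_mul_inner x (B y)
  rw [HasSum, SummationFilter.unconditional_filter]
  simpa only [ContinuousLinearMap.apply_apply, apply_basisProj_mul]
    using tendsto_of_mem_predual hbound hvec hω

theorem hasSum_trace_dens {ω : OpDual E} (hω : ω ∈ predual E) :
    HasSum (fun i => ⟪b i, dens ω (b i)⟫_ℂ) (ω 1) := hasSum_inner_dens b hω 1

theorem dens_injOn_predual : Set.InjOn dens (predual E : Set (OpDual E)) := by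
  intro ω hω η hη h
  obtain ⟨w, b, -⟩ := exists_hilbertBasis ℂ E
  ext B
  have hB := hasSum_inner_dens b hω B
  rw [h] at hB
  exact hB.unique (hasSum_inner_dens b hη B)

theorem exists_mem_predual_of_isPositive {ρ : E →L[ℂ] E} (hρ : ρ.IsPositive) {s : ℝ}
    (hs : HasSum (fun i => RCLike.re ⟪b i, ρ (b i)⟫_ℂ) s) :
    ∃ ω ∈ predual E, dens ω = ρ ∧ ‖ω‖ ≤ s := by
  have hρ0 : 0 ≤ ρ := (ContinuousLinearMap.nonneg_iff_isPositive ρ).2 hρ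
  set S : E →L[ℂ] E := CFC.sqrt ρ
  have hself : ∀ x y, ⟪S x, y⟫_ℂ = ⟪x, S y⟫_ℂ :=
    (CFC.sqrt_nonneg ρ).isSelfAdjoint.isSymmetric
  have hsq : ∀ x y, ⟪S x, S y⟫_ℂ = ⟪x, ρ y⟫_ℂ := fun x y => by
    rw [hself, ← mul_apply_eq_comp, CFC.sqrt_mul_sqrt_self ρ hρ0]
  have hbound : ∀ i, ‖vecFun (S (b i)) (S (b i))‖ ≤ RCLike.re ⟪b i, ρ (b i)⟫_ℂ := fun i =>
    (norm_vecFun_le _ _).trans_eq (by rw [← hsq, inner_self_eq_norm_mul_norm])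
  have hsum := (hs.summable.of_norm_bounded hbound).hasSum
  refine ⟨_, mem_predual_of_hasSum hsum fun i => vecFun_mem_predual _ _, op_ext fun x y => ?_,
    tsum_of_norm_bounded hs hbound⟩
  rw [inner_dens, ← hsq]
  refine (hsum.mapL (ContinuousLinearMap.apply ℂ ℂ (rankOne ℂ y x))).unique ?_
  refine (b.hasSum_inner_mul_inner (S x) (S y)).congr_fun fun i => ?_
  simp [hself]

-- `x / (|x| + ε)` stands in for the sign function, which is not continuous.
theorem exists_contraction_abs_le {A : E →L[ℂ] E} (hA : IsSelfAdjoint A) {ε : ℝ} (hε : 0 < ε) :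
    ∃ F : E →L[ℂ] E, ‖F‖ ≤ 1 ∧ 0 ≤ F * A ∧ CFC.abs A ≤ F * A + algebraMap ℝ _ ε := by
  have hden : ∀ x : ℝ, 0 < |x| + ε := fun x => by positivity
  have hcont : Continuous fun x : ℝ => x / (|x| + ε) :=
    continuous_id.div (by fun_prop) fun x => (hden x).ne'
  have hmul : cfc (fun x : ℝ => x / (|x| + ε)) A * A =
      cfc (fun x : ℝ => x / (|x| + ε) * x) A := by
    rw [cfc_mul _ (fun x : ℝ => x) A hcont.continuousOn (by fun_prop), cfc_id' ℝ A]
  have hsq : ∀ x : ℝ, x / (|x| + ε) * x = |x| ^ 2 / (|x| + ε) := fun x => by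
    rw [sq_abs]; ring
  refine ⟨cfc (fun x : ℝ => x / (|x| + ε)) A, norm_cfc_le zero_le_one fun x _ => ?_, ?_, ?_⟩
  · rw [norm_div, Real.norm_eq_abs, Real.norm_eq_abs, abs_of_pos (hden x)]
    exact (div_le_one (hden x)).2 (by linarith)
  · rw [hmul]
    exact cfc_nonneg fun x _ => by rw [hsq]; positivity
  · rw [hmul, ← cfc_add_const _ _ _ (by fun_prop), CFC.abs_eq_cfc_norm A hA]
    refine cfc_mono (fun x _ => ?_) (by fun_prop) (by fun_prop)
    rw [hsq, Real.norm_eq_abs, ← sub_le_iff_le_add, le_div_iff₀ (hden x)]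
    nlinarith [sq_nonneg ε]

theorem re_inner_abs_nonneg (A : E →L[ℂ] E) (x : E) : 0 ≤ RCLike.re ⟪x, CFC.abs A x⟫_ℂ :=
  re_inner_nonneg (CFC.abs_nonneg A) x

theorem sum_re_inner_abs_dens_le {ω : OpDual E} (hω : ω ∈ predual E)
    (hsa : IsSelfAdjoint (dens ω)) (s : Finset X) {ε : ℝ} (hε : 0 < ε) :
    ∑ i ∈ s, RCLike.re ⟪b i, CFC.abs (dens ω) (b i)⟫_ℂ ≤ ‖ω‖ + s.card * ε := by
  obtain ⟨F, hF, hpos, hle⟩ := exists_contraction_abs_le hsa hε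
  have hterm : ∀ i ∈ s, RCLike.re ⟪b i, CFC.abs (dens ω) (b i)⟫_ℂ ≤
      RCLike.re ⟪b i, F (dens ω (b i))⟫_ℂ + ε := fun i _ => by
    refine (re_inner_mono hle (b i)).trans_eq ?_
    rw [Algebra.algebraMap_eq_smul_one]
    simp [inner_smul_right_eq_smul, b.orthonormal.1 i]
  calc ∑ i ∈ s, RCLike.re ⟪b i, CFC.abs (dens ω) (b i)⟫_ℂ
      ≤ ∑ i ∈ s, RCLike.re ⟪b i, F (dens ω (b i))⟫_ℂ + s.card * ε := by
        simpa [Finset.sum_add_distrib] using Finset.sum_le_sum hterm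
    _ ≤ RCLike.re (ω F) + s.card * ε := by
        gcongr
        exact sum_le_hasSum s (fun i _ => re_inner_nonneg hpos (b i))
          (RCLike.hasSum_re ℂ (hasSum_inner_dens b hω F))
    _ ≤ ‖ω‖ + s.card * ε := by
        gcongr
        exact (RCLike.re_le_norm _).trans (by simpa using ω.le_opNorm_of_le hF)

theorem traceNorm_dens_le {ω : OpDual E} (hω : ω ∈ predual E) (hsa : IsSelfAdjoint (dens ω)) :
    traceNorm b (dens ω) ≤ ENNReal.ofReal ‖ω‖ := by
  rw [traceNorm, ENNReal.tsum_eq_iSup_sum]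
  refine iSup_le fun s => ?_
  rw [← ENNReal.ofReal_sum_of_nonneg fun i _ => re_inner_abs_nonneg _ (b i)]
  refine ENNReal.ofReal_le_ofReal (le_of_forall_pos_le_add fun δ hδ => ?_)
  refine (sum_re_inner_abs_dens_le b hω hsa s (ε := δ / (s.card + 1)) (by positivity)).trans ?_
  gcongr
  rw [mul_div_assoc', div_le_iff₀ (by positivity)]
  nlinarith

theorem exists_mem_predual_of_traceNorm_ne_top {A : E →L[ℂ] E} (hA : IsSelfAdjoint A)
    (h : traceNorm b A ≠ ⊤) :
    ∃ ω ∈ predual E, dens ω = A ∧ ‖ω‖ ≤ (traceNorm b A).toReal := by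
  have habs : HasSum (fun i => RCLike.re ⟪b i, CFC.abs A (b i)⟫_ℂ) (traceNorm b A).toReal := by
    rw [traceNorm, ENNReal.tsum_toReal_eq fun _ => ENNReal.ofReal_ne_top]
    exact (ENNReal.summable_toReal h).hasSum.congr_fun fun i =>
      (ENNReal.toReal_ofReal (re_inner_abs_nonneg _ (b i))).symm
  have hsplit : ∀ i, RCLike.re ⟪b i, CFC.abs A (b i)⟫_ℂ =
      RCLike.re ⟪b i, A⁺ (b i)⟫_ℂ + RCLike.re ⟪b i, A⁻ (b i)⟫_ℂ := fun i => by
    rw [← CFC.posPart_add_negPart A hA]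
    simp
  have hpos : ∀ i, 0 ≤ RCLike.re ⟪b i, A⁺ (b i)⟫_ℂ := fun i =>
    re_inner_nonneg (CFC.posPart_nonneg A) (b i)
  have hneg : ∀ i, 0 ≤ RCLike.re ⟪b i, A⁻ (b i)⟫_ℂ := fun i =>
    re_inner_nonneg (CFC.negPart_nonneg A) (b i)
  have sumPos : Summable fun i => RCLike.re ⟪b i, A⁺ (b i)⟫_ℂ :=
    habs.summable.of_nonneg_of_le hpos fun i => by linarith [hsplit i, hneg i]
  have sumNeg : Summable fun i => RCLike.re ⟪b i, A⁻ (b i)⟫_ℂ :=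
    habs.summable.of_nonneg_of_le hneg fun i => by linarith [hsplit i, hpos i]
  obtain ⟨ω, hω, hdω, hnω⟩ := exists_mem_predual_of_isPositive b
    ((ContinuousLinearMap.nonneg_iff_isPositive _).1 (CFC.posPart_nonneg A)) sumPos.hasSum
  obtain ⟨η, hη, hdη, hnη⟩ := exists_mem_predual_of_isPositive b
    ((ContinuousLinearMap.nonneg_iff_isPositive _).1 (CFC.negPart_nonneg A)) sumNeg.hasSum
  refine ⟨ω - η, (predual E).sub_mem hω hη, ?_, ?_⟩
  · rw [map_sub, hdω, hdη, CFC.posPart_sub_negPart A hA]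
  · rw [habs.unique ((sumPos.hasSum.add sumNeg.hasSum).congr_fun hsplit)]
    exact (norm_sub_le _ _).trans (add_le_add hnω hnη)

end Trace

/-! ### Matrix entries and partial traces -/

section Entry

variable {X Y : Type*}

theorem stdBasis_apply [DecidableEq X] (x y : X) : stdBasis X x y = if y = x then 1 else 0 := by
  have hsingle : stdBasis X x = lp.single 2 x (1 : ℂ) := ((stdBasis X).repr_symm_single x).symm
  rw [hsingle]
  change (lp.single (E := fun _ : X => ℂ) 2 x (1 : ℂ) : _) y = _
  simp [Pi.single_apply]

theorem inner_stdBasis (x : X) (φ : L2 X) : ⟪stdBasis X x, φ⟫_ℂ = φ x :=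
  ((stdBasis X).repr_apply_apply φ x).symm

theorem val_zero (x : X) : (0 : L2 X) x = 0 := rfl

/-- The matrix entries of a bounded operator in the canonical basis. Identities between operators
on tensor products are checked on matrix entries. -/
def entry (A : Op X) (x y : X) : ℂ := ⟪stdBasis X x, A (stdBasis X y)⟫_ℂ

theorem entry_eq (A : Op X) (x y : X) : entry A x y = A (stdBasis X y) x := inner_stdBasis _ _

theorem entry_add (A B : Op X) (x y : X) : entry (A + B) x y = entry A x y + entry B x y := by
  simp [entry]

theorem entry_smul (c : ℂ) (A : Op X) (x y : X) : entry (c • A) x y = c * entry A x y := by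
  simp [entry]

theorem entry_sum {α : Type*} (s : Finset α) (A : α → Op X) (x y : X) :
    entry (∑ i ∈ s, A i) x y = ∑ i ∈ s, entry (A i) x y := by
  simp only [entry, sum_apply, inner_sum]

theorem entry_ext {A B : Op X} (h : ∀ x y, entry A x y = entry B x y) : A = B := by
  refine ContinuousLinearMap.ext_on
    (Submodule.dense_iff_topologicalClosure_eq_top.2 (stdBasis X).dense_span) ?_
  rintro _ ⟨y, rfl⟩
  ext x
  simpa only [entry_eq] using h x y

theorem entry_one [DecidableEq X] (x y : X) : entry (1 : Op X) x y = if x = y then 1 else 0 := by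
  rw [entry_eq, one_apply_eq_self, stdBasis_apply]

theorem hasSum_entry_mul (A B : Op X) (x z : X) :
    HasSum (fun y => entry A x y * entry B y z) (entry (A * B) x z) := by
  have h := (stdBasis X).hasSum_inner_mul_inner (A.adjoint (stdBasis X x)) (B (stdBasis X z))
  simp only [ContinuousLinearMap.adjoint_inner_left] at h
  exact h

theorem entry_star (A : Op X) (x y : X) : entry (star A) x y = star (entry A y x) := by
  rw [entry, ContinuousLinearMap.star_eq_adjoint, ContinuousLinearMap.adjoint_inner_right,
    ← inner_conj_symm]
  rfl

/-- The matrix unit `|x⟩⟨y|`. -/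
def matUnit (x y : X) : Op X := rankOne ℂ (stdBasis X x) (stdBasis X y)

theorem entry_matUnit [DecidableEq X] (a b x y : X) :
    entry (matUnit a b) x y = if x = a ∧ y = b then 1 else 0 := by
  rw [entry_eq, matUnit, InnerProductSpace.rankOne_apply, inner_stdBasis]
  simp only [stdBasis_apply, L2.smul_apply, mul_ite, mul_one, mul_zero]
  grind

theorem entry_dens (ω : OpDual (L2 X)) (x y : X) : entry (dens ω) x y = ω (matUnit y x) :=
  inner_dens ω _ _

theorem eq_of_apply_matUnit {ω η : OpDual (L2 X)} (hω : ω ∈ predual (L2 X))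
    (hη : η ∈ predual (L2 X)) (h : ∀ x y, ω (matUnit x y) = η (matUnit x y)) : ω = η :=
  dens_injOn_predual hω hη <| entry_ext fun x y => by rw [entry_dens, entry_dens, h]

theorem entry_transport (e : X ≃ Y) (A : Op Y) (x y : X) :
    entry (transport e A) x y = entry A (e x) (e y) := by
  classical
  have hbasis : (reindex e).symm (stdBasis X y) = stdBasis Y (e y) := by
    ext a
    simp [stdBasis_apply, Equiv.symm_apply_eq]
  rw [entry_eq, entry_eq, ← hbasis]
  rfl

theorem transport_matUnit (e : X ≃ Y) (x y : Y) :
    transport e (matUnit x y) = matUnit (e.symm x) (e.symm y) := by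
  classical
  exact entry_ext fun a c => by simp only [entry_transport, entry_matUnit, Equiv.eq_symm_apply]

theorem slice_stdBasis [DecidableEq Y] (x : X) (y y' : Y) :
    slice X y' (stdBasis (X × Y) (x, y)) = if y' = y then stdBasis X x else 0 := by
  classical
  ext a
  rw [slice_apply, stdBasis_apply]
  split_ifs <;> simp_all [stdBasis_apply, val_zero]

theorem entry_tensorOp (A : Op X) (B : Op Y) (p q : X × Y) :
    entry (tensorOp A B) p q = entry A p.1 q.1 * entry B p.2 q.2 := by
  classical
  have hslice : slice X p.2 (transport (Equiv.prodComm X Y) (tensorOne X B) (stdBasis _ q)) =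
      entry B p.2 q.2 • stdBasis X q.1 := by
    have hswap : (reindex (Equiv.prodComm X Y)).symm (stdBasis _ q) = stdBasis (Y × X) q.swap := by
      ext a
      simp [stdBasis_apply, Prod.swap_eq_iff_eq_swap]
    ext a
    change tensorOne X B ((reindex (Equiv.prodComm X Y)).symm (stdBasis _ q)) (p.2, a) = _
    rw [hswap, tensorOne_apply, Prod.swap, slice_stdBasis, L2.smul_apply, stdBasis_apply, entry_eq]
    split_ifs <;> simp [val_zero]
  rw [entry_eq, tensorOp, mul_apply_eq_comp, tensorOne_apply, hslice, map_smul, L2.smul_apply,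
    entry_eq A, mul_comm]

theorem tensorOp_one (A : Op X) : tensorOp A (1 : Op Y) = tensorOne Y A := mul_one _

theorem entry_tensorOne [DecidableEq Y] (A : Op X) (p q : X × Y) :
    entry (tensorOne Y A) p q = if p.2 = q.2 then entry A p.1 q.1 else 0 := by
  rw [← tensorOp_one, entry_tensorOp, entry_one, mul_ite, mul_one, mul_zero]

theorem entry_tensorPow {H : Type*} [NormedAddCommGroup H] [InnerProductSpace ℂ H] {ι : Type*}
    (b : HilbertBasis ι ℂ H) (ρ : H →L[ℂ] H) (k : ℕ) (α β : Fin k → ι) :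
    entry (tensorPow b ρ k) α β = ∏ i, ⟪b (α i), ρ (b (β i))⟫_ℂ := by
  classical
  induction k with
  | zero => simp [tensorPow, entry_one, Subsingleton.elim α β]
  | succ k ih =>
    have hcoords : ∀ i, (coords b).symm (stdBasis ι i) = b i := fun i =>
      (coords b).symm_apply_eq.2 <| by
        ext j
        simp [coords_apply, stdBasis_apply, orthonormal_iff_ite.1 b.orthonormal]
    rw [tensorPow, entry_transport, entry_tensorOp, ih, Fin.prod_univ_succ, entry_eq]
    simp [hcoords, coords_apply, Fin.consEquiv, Fin.tail]

end Entry

section PartialTrace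

variable {X Y : Type*}

theorem tensorOne_mul (A B : Op X) : tensorOne Y (A * B) = tensorOne Y A * tensorOne Y B := rfl

theorem norm_tensorOp_le (A : Op X) (B : Op Y) : ‖tensorOp A B‖ ≤ ‖A‖ * ‖B‖ :=
  (norm_mul_le _ _).trans <| mul_le_mul (norm_tensorOne_le A)
    ((norm_transport_le _ _).trans (norm_tensorOne_le B)) (norm_nonneg _) (norm_nonneg _)

/-- `A ↦ A ⊗ B` as a bounded map. -/
def tensorOpL (X : Type*) {Y : Type*} (B : Op Y) : Op X →L[ℂ] Op (X × Y) :=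
  LinearMap.mkContinuous
    { toFun := fun A => tensorOp A B
      map_add' := fun A A' => entry_ext fun p q => by simp [entry_tensorOp, entry_add, add_mul]
      map_smul' := fun c A => entry_ext fun p q => by
        simp [entry_tensorOp, entry_smul, mul_assoc] } ‖B‖
    fun A => (norm_tensorOp_le A B).trans_eq (mul_comm _ _)

@[simp] theorem tensorOpL_apply (A : Op X) (B : Op Y) : tensorOpL X B A = tensorOp A B := rfl

theorem norm_tensorOpL_le (B : Op Y) : ‖tensorOpL X B‖ ≤ ‖B‖ :=
  LinearMap.mkContinuous_norm_le _ (norm_nonneg _) _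

/-- `transport` as a bounded map. -/
def transportL (e : X ≃ Y) : Op Y →L[ℂ] Op X :=
  LinearMap.mkContinuous
    { toFun := transport e
      map_add' := fun A B => entry_ext fun x y => by simp [entry_transport, entry_add]
      map_smul' := fun c A => entry_ext fun x y => by simp [entry_transport, entry_smul] } 1
    fun A => (norm_transport_le e A).trans_eq (one_mul _).symm

@[simp] theorem transportL_apply (e : X ≃ Y) (A : Op Y) : transportL e A = transport e A := rfl

theorem comp_transportL_mem_predual (e : X ≃ Y) {ω : OpDual (L2 X)} (hω : ω ∈ predual (L2 X)) :
    ω ∘L transportL e ∈ predual (L2 Y) := by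
  refine comp_mem_predual (fun x y => ?_) hω
  have hvec : vecFun x y ∘L transportL e = vecFun ((reindex e).symm x) ((reindex e).symm y) := by
    ext A
    rw [vecFun_apply, ← (reindex e).inner_map_map, LinearIsometryEquiv.apply_symm_apply]
    rfl
  rw [hvec]
  exact vecFun_mem_predual _ _

theorem dens_comp_transportL (e : X ≃ Y) (ω : OpDual (L2 X)) :
    dens (ω ∘L transportL e) = transport e.symm (dens ω) :=
  entry_ext fun x y => by simp [entry_transport, entry_dens, transport_matUnit]

theorem tensorOp_matUnit (A : Op X) (y : Y) :
    tensorOp A (matUnit y y) = (slice X y).adjoint ∘L A ∘L slice X y := by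
  classical
  refine entry_ext fun p q => ?_
  rw [entry_tensorOp, entry_matUnit, entry, entry, ContinuousLinearMap.comp_apply,
    ContinuousLinearMap.adjoint_inner_right, slice_stdBasis, ContinuousLinearMap.comp_apply,
    slice_stdBasis]
  split_ifs <;> simp_all

theorem vecFun_comp_tensorOpL_matUnit (x z : L2 (X × Y)) (y : Y) :
    vecFun x z ∘L tensorOpL X (matUnit y y) = vecFun (slice X y x) (slice X y z) := by
  ext A
  simp [tensorOp_matUnit, ContinuousLinearMap.adjoint_inner_right]

theorem dens_comp_tensorOpL_matUnit (ω : OpDual (L2 (X × Y))) (y : Y) :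
    dens (ω ∘L tensorOpL X (matUnit y y)) = slice X y ∘L dens ω ∘L (slice X y).adjoint := by
  refine op_ext fun x z => ?_
  rw [inner_dens, ContinuousLinearMap.comp_apply, ContinuousLinearMap.comp_apply,
    ← ContinuousLinearMap.adjoint_inner_left, ContinuousLinearMap.comp_apply, inner_dens,
    tensorOpL_apply, tensorOp_matUnit, InnerProductSpace.rankOne_comp,
    InnerProductSpace.comp_rankOne]

theorem hasSum_vecFun_slice (x z : L2 (X × Y)) :
    HasSum (fun y => vecFun (slice X y x) (slice X y z))
      (vecFun x z ∘L tensorOpL X (1 : Op Y)) := by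
  have hsum : Summable fun y => vecFun (slice X y x) (slice X y z) := by
    refine Summable.of_norm_bounded
      ((hasSum_norm_slice x).summable.add (hasSum_norm_slice z).summable) fun y => ?_
    refine (norm_vecFun_le _ _).trans ?_
    nlinarith [two_mul_le_add_sq ‖slice X y x‖ ‖slice X y z‖, sq_nonneg ‖slice X y x‖,
      sq_nonneg ‖slice X y z‖]
  have hinner : ∀ u v : L2 (X × Y), HasSum (fun y => ⟪slice X y u, slice X y v⟫_ℂ) ⟪u, v⟫_ℂ :=
    fun u v => ((Equiv.prodComm Y X).hasSum_iff.2
      (lp.hasSum_inner (𝕜 := ℂ) (G := fun _ : X × Y => ℂ) u v)).prod_fiberwise fun y =>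
        lp.hasSum_inner (𝕜 := ℂ) (G := fun _ : X => ℂ) (slice X y u) (slice X y v)
  convert hsum.hasSum using 1
  ext A
  rw [ContinuousLinearMap.comp_apply, tensorOpL_apply, tensorOp_one]
  exact (hinner x (tensorOne Y A z)).unique (hsum.hasSum.mapL (ContinuousLinearMap.apply ℂ ℂ A))

theorem comp_tensorOpL_one_mem_predual {ω : OpDual (L2 (X × Y))}
    (hω : ω ∈ predual (L2 (X × Y))) : ω ∘L tensorOpL X (1 : Op Y) ∈ predual (L2 X) :=
  comp_mem_predual (fun x z => mem_predual_of_hasSum (hasSum_vecFun_slice x z)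
    fun _ => vecFun_mem_predual _ _) hω

theorem tensorOpL_basisProj (s : Finset Y) :
    tensorOpL X (basisProj (stdBasis Y) s) = ∑ y ∈ s, tensorOpL X (matUnit y y) := by
  ext1 A
  refine entry_ext fun p q => ?_
  simp only [tensorOpL_apply, sum_apply, entry_sum, entry_tensorOp, basisProj, matUnit,
    Finset.mul_sum]

theorem hasSum_comp_tensorOpL_matUnit {ω : OpDual (L2 (X × Y))} (hω : ω ∈ predual (L2 (X × Y))) :
    HasSum (fun y => ω ∘L tensorOpL X (matUnit y y)) (ω ∘L tensorOpL X (1 : Op Y)) := by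
  let P : Op Y → OpDual (L2 (X × Y)) →L[ℂ] OpDual (L2 X) := fun B =>
    (ContinuousLinearMap.compL ℂ _ _ _).flip (tensorOpL X B)
  have hbound : ∀ s, ‖P (basisProj (stdBasis Y) s)‖ ≤ (1 : NNReal) := fun s => by
    refine ContinuousLinearMap.opNorm_le_bound _ zero_le_one fun η => ?_
    refine (η.opNorm_comp_le _).trans ?_
    rw [mul_comm]
    gcongr
    exact (norm_tensorOpL_le _).trans (norm_basisProj_le _ s)
  have hP : ∀ η s, P (basisProj (stdBasis Y) s) η = ∑ y ∈ s, η ∘L tensorOpL X (matUnit y y) :=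
    fun η s => by
      change η ∘L tensorOpL X _ = _
      rw [tensorOpL_basisProj, ContinuousLinearMap.comp_finsetSum]
  have hvec : ∀ x z, Tendsto (fun s => P (basisProj (stdBasis Y) s) (vecFun x z)) atTop
      (𝓝 (P 1 (vecFun x z))) := fun x z => by
    simp only [hP, vecFun_comp_tensorOpL_matUnit]
    have hslice := hasSum_vecFun_slice x z
    rw [HasSum, SummationFilter.unconditional_filter] at hslice
    exact hslice
  rw [HasSum, SummationFilter.unconditional_filter]
  exact (tendsto_of_mem_predual hbound hvec hω).congr (hP ω)

theorem partialTrace_dens {ω : OpDual (L2 (X × Y))} (hω : ω ∈ predual (L2 (X × Y))) :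
    partialTrace (dens ω) = dens (ω ∘L tensorOpL X (1 : Op Y)) := by
  have hsum := (hasSum_comp_tensorOpL_matUnit hω).mapL (dens (E := L2 X))
  simp only [dens_comp_tensorOpL_matUnit] at hsum
  exact hsum.tsum_eq

end PartialTrace

/-! ### Operators acting on some of the factors -/

section Embed

variable {ι V W Z U : Type*}

open Classical in
/-- The splitting of a family over `W` into its restriction along `f : V ↪ W` and the entries
outside the range of `f`. -/
def embSplit (ι : Type*) (f : V ↪ W) : (W → ι) ≃ (V → ι) × ({w // w ∉ Set.range f} → ι) :=
  (Equiv.piEquivPiSubtypeProd (· ∈ Set.range f) fun _ => ι).trans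
    (Equiv.prodCongr ((Equiv.ofInjective f f.injective).arrowCongr (.refl ι)).symm (.refl _))

theorem embSplit_fst (f : V ↪ W) (x : W → ι) : (embSplit ι f x).1 = x ∘ f := rfl

theorem embSplit_snd_eq_iff (f : V ↪ W) (x y : W → ι) :
    (embSplit ι f x).2 = (embSplit ι f y).2 ↔ ∀ w ∉ Set.range f, x w = y w :=
  funext_iff.trans Subtype.forall

/-- The operator on `ℓ²(ι ^ W)` that acts as `A` on the factors in the range of `f`. -/
def embed (f : V ↪ W) : Op (V → ι) →L[ℂ] Op (W → ι) :=
  transportL (embSplit ι f) ∘L tensorOpL _ 1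

theorem embed_apply (f : V ↪ W) (A : Op (V → ι)) :
    embed f A = transport (embSplit ι f) (tensorOne _ A) := by
  rw [← tensorOp_one]
  rfl

open Classical in
theorem entry_embed (f : V ↪ W) (A : Op (V → ι)) (x y : W → ι) :
    entry (embed f A) x y =
      if ∀ w ∉ Set.range f, x w = y w then entry A (x ∘ f) (y ∘ f) else 0 := by
  simp only [embed_apply, entry_transport, entry_tensorOne, embSplit_fst, embSplit_snd_eq_iff]

theorem transport_tensorOne_eq_embed {Y : Type*} (f : V ↪ W) (e : (W → ι) ≃ (V → ι) × Y)
    (hfst : ∀ x, (e x).1 = x ∘ f)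
    (hsnd : ∀ x y, (e x).2 = (e y).2 ↔ ∀ w ∉ Set.range f, x w = y w) (A : Op (V → ι)) :
    transport e (tensorOne Y A) = embed f A := by
  classical
  exact entry_ext fun x y => by
    simp only [entry_embed, entry_transport, entry_tensorOne, hfst, hsnd]

theorem embed_trans (f : V ↪ W) (g : W ↪ Z) (A : Op (V → ι)) :
    embed (f.trans g) A = embed g (embed f A) := by
  classical
  refine entry_ext fun x y => ?_
  have hrange : (∀ z ∉ Set.range (f.trans g), x z = y z) ↔
      (∀ z ∉ Set.range g, x z = y z) ∧ ∀ w ∉ Set.range f, x (g w) = y (g w) := by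
    refine ⟨fun h => ⟨fun z hz => h z ?_, fun w hw => h (g w) ?_⟩, fun h z hz => ?_⟩
    · rintro ⟨v, rfl⟩
      exact hz ⟨f v, rfl⟩
    · rintro ⟨v, hv⟩
      exact hw ⟨v, g.injective hv⟩
    · by_cases hg : z ∈ Set.range g
      · obtain ⟨w, rfl⟩ := hg
        exact h.2 w fun ⟨v, hv⟩ => hz ⟨v, congrArg g hv⟩
      · exact h.1 z hg
  simp only [entry_embed, hrange, ite_and]
  rfl

theorem embed_mul (f : V ↪ W) (A B : Op (V → ι)) : embed f (A * B) = embed f A * embed f B := by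
  ext1 x
  simp [embed_apply, transport, tensorOne_mul]

theorem embed_one (f : V ↪ W) : embed f (1 : Op (V → ι)) = 1 := by
  classical
  refine entry_ext fun x y => ?_
  rw [entry_embed, entry_one, entry_one, ← ite_and]
  refine if_congr ⟨fun h => funext fun w => ?_, by rintro rfl; simp⟩ rfl rfl
  by_cases hw : w ∈ Set.range f
  · obtain ⟨v, rfl⟩ := hw
    exact congrFun h.2 v
  · exact h.1 w hw

theorem embed_star (f : V ↪ W) (A : Op (V → ι)) : embed f (star A) = star (embed f A) := by
  classical
  refine entry_ext fun x y => ?_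
  simp only [entry_star, entry_embed, apply_ite star, star_zero, eq_comm]

theorem norm_embed_apply_le (f : V ↪ W) (A : Op (V → ι)) : ‖embed f A‖ ≤ ‖A‖ := by
  rw [embed_apply]
  exact (norm_transport_le _ _).trans (norm_tensorOne_le _)

theorem norm_embed_le (f : V ↪ W) : ‖(embed f : Op (V → ι) →L[ℂ] Op (W → ι))‖ ≤ 1 :=
  ContinuousLinearMap.opNorm_le_bound _ zero_le_one fun A =>
    (norm_embed_apply_le f A).trans_eq (one_mul _).symm

open Classical in
theorem entry_embed_mul_embed {f : V ↪ W} {g : U ↪ W} (hfg : Disjoint (Set.range f) (Set.range g))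
    (A : Op (V → ι)) (B : Op (U → ι)) (x y : W → ι) :
    entry (embed f A * embed g B) x y =
      if ∀ w ∉ Set.range f ∪ Set.range g, x w = y w then
        entry A (x ∘ f) (y ∘ f) * entry B (x ∘ g) (y ∘ g) else 0 := by
  let z₀ : W → ι := (Set.range f).piecewise y x
  have hz₀ : ∀ z, z ≠ z₀ → entry (embed f A) x z * entry (embed g B) z y = 0 := fun z hz => by
    rw [entry_embed, entry_embed]
    split_ifs with hx hy
    · refine absurd (funext fun w => ?_) hz
      by_cases hw : w ∈ Set.range f
      · exact (hy w (hfg.notMem_of_mem_left hw)).trans (Set.piecewise_eq_of_mem _ _ _ hw).symm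
      · exact (hx w hw).symm.trans (Set.piecewise_eq_of_notMem _ _ _ hw).symm
    all_goals simp
  have hoff : ∀ w ∉ Set.range f, z₀ w = x w := fun w => Set.piecewise_eq_of_notMem _ _ _
  have hz₀f : z₀ ∘ f = y ∘ f := funext fun v => Set.piecewise_eq_of_mem _ _ _ ⟨v, rfl⟩
  have hz₀g : z₀ ∘ g = x ∘ g := funext fun u => hoff _ (hfg.notMem_of_mem_right ⟨u, rfl⟩)
  have hcond : (∀ w ∉ Set.range g, z₀ w = y w) ↔
      ∀ w ∉ Set.range f ∪ Set.range g, x w = y w := by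
    refine forall_congr' fun w => ?_
    by_cases hw : w ∈ Set.range f
    · simp [z₀, hw, Set.piecewise_eq_of_mem]
    · simp only [hoff w hw, Set.mem_union, hw, false_or]
  rw [(hasSum_entry_mul _ _ x y).unique (hasSum_single z₀ hz₀), entry_embed, entry_embed,
    if_pos fun w hw => (hoff w hw).symm, hz₀f, hz₀g, mul_ite, mul_zero]
  exact if_congr hcond rfl rfl

theorem embed_comm {f : V ↪ W} {g : U ↪ W} (hfg : Disjoint (Set.range f) (Set.range g))
    (A : Op (V → ι)) (B : Op (U → ι)) : Commute (embed f A) (embed g B) := by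
  classical
  refine entry_ext fun x y => ?_
  rw [entry_embed_mul_embed hfg, entry_embed_mul_embed hfg.symm, Set.union_comm, mul_comm]

theorem disjoint_range_castAddEmb_natAddEmb (k l : ℕ) :
    Disjoint (Set.range (Fin.castAddEmb l : Fin k ↪ Fin (k + l)))
      (Set.range (Fin.natAddEmb k : Fin l ↪ Fin (k + l))) := by
  rw [Set.disjoint_range_iff]
  intro v u h
  have hval := congrArg Fin.val h
  simp only [Fin.castAddEmb_apply, Fin.val_castAdd, Fin.natAddEmb_apply, Fin.val_natAdd] at hval
  omega

theorem embed_matUnit_mul {k l : ℕ} (α β : Fin k → ι) (γ δ : Fin l → ι) :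
    embed (Fin.castAddEmb l) (matUnit α β) * embed (Fin.natAddEmb k) (matUnit γ δ) =
      matUnit (Fin.append α γ) (Fin.append β δ) := by
  classical
  have happend : ∀ (x : Fin (k + l) → ι) (a : Fin k → ι) (c : Fin l → ι), x = Fin.append a c ↔
      x ∘ Fin.castAddEmb l = a ∧ x ∘ Fin.natAddEmb k = c := fun x a c =>
    (Equiv.eq_symm_apply (x := (a, c)) (Fin.appendEquiv k l).symm).trans Prod.ext_iff
  refine entry_ext fun x y => ?_
  rw [entry_embed_mul_embed (disjoint_range_castAddEmb_natAddEmb k l), if_pos]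
  · simp only [entry_matUnit, happend]
    grind
  · intro w
    refine Fin.addCases (fun v hv => ?_) (fun u hu => ?_) w
    · exact absurd (Or.inl ⟨v, rfl⟩) hv
    · exact absurd (Or.inr ⟨u, rfl⟩) hu

theorem comp_embed_mem_predual (f : V ↪ W) {ω : OpDual (L2 (W → ι))}
    (hω : ω ∈ predual (L2 (W → ι))) : ω ∘L embed f ∈ predual (L2 (V → ι)) :=
  comp_tensorOpL_one_mem_predual (comp_transportL_mem_predual (embSplit ι f) hω)

theorem marginal_dens (k m : ℕ) {ω : OpDual (L2 (Fin (k + m) → ι))}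
    (hω : ω ∈ predual (L2 (Fin (k + m) → ι))) :
    marginal k m (dens ω) = dens (ω ∘L embed (Fin.castAddEmb m)) := by
  have hsnd : ∀ x y : Fin (k + m) → ι,
      ((Fin.appendEquiv k m).symm x).2 = ((Fin.appendEquiv k m).symm y).2 ↔
        ∀ w ∉ Set.range (Fin.castAddEmb m), x w = y w := fun x y => by
    refine funext_iff.trans ⟨fun h w => ?_, fun h u => h _ ?_⟩
    · exact Fin.addCases (fun v hv => absurd ⟨v, rfl⟩ hv) (fun u _ => h u) w
    · exact (disjoint_range_castAddEmb_natAddEmb k m).notMem_of_mem_right ⟨u, rfl⟩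
  have htransport := dens_comp_transportL (Fin.appendEquiv k m).symm ω
  rw [Equiv.symm_symm] at htransport
  rw [marginal, ← htransport, partialTrace_dens (comp_transportL_mem_predual _ hω)]
  congr 1
  ext A
  simp only [ContinuousLinearMap.comp_apply, tensorOpL_apply, transportL_apply, tensorOp_one]
  rw [transport_tensorOne_eq_embed (Fin.castAddEmb m) _ (fun _ => rfl) hsnd]

/-- Two distinct labels as an embedding. -/
def pairEmb {i j : V} (hij : i ≠ j) : Fin 2 ↪ V where
  toFun := ![i, j]
  inj' a c h := by
    fin_cases a <;> fin_cases c <;> simp_all [hij.symm]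

theorem range_pairEmb {i j : V} (hij : i ≠ j) : Set.range (pairEmb hij) = {i, j} :=
  Matrix.range_cons_cons_empty i j ![]

theorem pairOp_eq_embed {N : ℕ} {i j : Fin N} (hij : i ≠ j) (A : NOp ι 2) :
    pairOp hij A = embed (pairEmb hij) A := by
  refine transport_tensorOne_eq_embed (pairEmb hij) (pairSplit ι hij) (fun x => ?_)
    (fun x y => ?_) A
  · funext v
    fin_cases v <;> rfl
  · rw [range_pairEmb]
    refine funext_iff.trans (Subtype.forall.trans (forall_congr' fun w => ?_))
    simp only [Set.mem_insert_iff, Set.mem_singleton_iff, not_or]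
    rfl

theorem permOp_conj {N : ℕ} (π : Equiv.Perm (Fin N)) (A : NOp ι N) :
    permOp ι π * A * star (permOp ι π) = embed π.symm.toEmbedding A := by
  classical
  have hstar : star (permOp ι π) =
      ((reindex (Equiv.arrowCongr π (Equiv.refl ι))).symm : L2 (Fin N → ι) →L[ℂ] _) :=
    (reindex (Equiv.arrowCongr π (Equiv.refl ι))).adjoint_eq_symm
  have htransport : permOp ι π * A * star (permOp ι π) =
      transport (Equiv.arrowCongr π (Equiv.refl ι)) A := by
    rw [hstar]
    rfl
  rw [htransport]
  refine entry_ext fun x y => ?_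
  have hrange : ∀ w, w ∈ Set.range π.symm.toEmbedding := π.symm.surjective
  rw [entry_transport, entry_embed, if_pos fun w hw => absurd (hrange w) hw]
  rfl

end Embed

/-! ### Averaged collisions -/

section Exponential

variable {𝔸 : Type*} [NormedRing 𝔸] [NormedAlgebra ℂ 𝔸] [CompleteSpace 𝔸]

theorem hasSum_exp_smul (a : 𝔸) (c : ℂ) :
    HasSum (fun n : ℕ => (c ^ n / n.factorial) • a ^ n) (NormedSpace.exp (c • a)) :=
  (NormedSpace.exp_series_hasSum_exp' (𝕂 := ℂ) (c • a)).congr_fun fun n => by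
    rw [smul_pow, smul_smul, div_eq_inv_mul]

theorem exp_add_smul (a : 𝔸) (s t : ℂ) :
    NormedSpace.exp ((s + t) • a) = NormedSpace.exp (s • a) * NormedSpace.exp (t • a) := by
  let _ : NormedAlgebra ℚ 𝔸 := NormedAlgebra.restrictScalars ℚ ℂ 𝔸
  rw [add_smul]
  exact NormedSpace.exp_add_of_commute (((Commute.refl a).smul_left s).smul_right t)

theorem exp_smul_sub_one (a : 𝔸) (c : ℂ) :
    NormedSpace.exp (c • (a - 1)) = Complex.exp (-c) • NormedSpace.exp (c • a) := by
  let _ : NormedAlgebra ℚ 𝔸 := NormedAlgebra.restrictScalars ℚ ℂ 𝔸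
  have hsplit : c • (a - 1) = c • a + algebraMap ℂ 𝔸 (-c) := by
    rw [Algebra.algebraMap_eq_smul_one, smul_sub, neg_smul, sub_eq_add_neg]
  rw [hsplit, NormedSpace.exp_add_of_commute (Algebra.commutes' (-c) _).symm,
    ← NormedSpace.algebraMap_exp_comm, ← Complex.exp_eq_exp_ℂ, Algebra.algebraMap_eq_smul_one,
    mul_smul_comm, mul_one]

theorem exp_mem_of_forall_pow_mem {M : Submodule ℂ 𝔸} (hM : IsClosed (M : Set 𝔸)) {a : 𝔸}
    (h : ∀ n : ℕ, a ^ n ∈ M) : NormedSpace.exp a ∈ M :=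
  hM.mem_of_tendsto (NormedSpace.exp_series_hasSum_exp' (𝕂 := ℂ) a) <|
    .of_forall fun _ => M.sum_mem fun n _ => M.smul_mem _ (h n)

end Exponential

/-- The bounded linear maps on the bounded operators on `E`. -/
abbrev SuperOp (E : Type*) [NormedAddCommGroup E] [InnerProductSpace ℂ E] :=
  (E →L[ℂ] E) →L[ℂ] (E →L[ℂ] E)

section Positive

variable {E : Type*} [NormedAddCommGroup E] [InnerProductSpace ℂ E]

theorem isClosed_isPositive : IsClosed {A : E →L[ℂ] E | A.IsPositive} := by
  simp only [ContinuousLinearMap.isPositive_iff_complex, Set.ofPred_forall]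
  refine isClosed_iInter fun x => ?_
  have hinner : Continuous fun A : E →L[ℂ] E => ⟪A x, x⟫_ℂ := by fun_prop
  have hre := RCLike.continuous_re.comp hinner
  exact (isClosed_eq (Complex.continuous_ofReal.comp hre) hinner).inter
    (isClosed_le continuous_const hre)

theorem isPositive_ofReal_smul {A : E →L[ℂ] E} (hA : A.IsPositive) {r : ℝ} (hr : 0 ≤ r) :
    ((r : ℂ) • A).IsPositive :=
  hA.smul_of_nonneg (by exact_mod_cast hr)

theorem convex_isPositive : Convex ℝ {A : E →L[ℂ] E | A.IsPositive} := by
  intro A hA B hB r s hr hs _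
  have hsum := (isPositive_ofReal_smul hA hr).add (isPositive_ofReal_smul hB hs)
  rwa [Complex.coe_smul, Complex.coe_smul] at hsum

theorem isPositive_exp_smul_apply [CompleteSpace E]
    {Q : SuperOp E} (hQ : ∀ {A}, A.IsPositive → (Q A).IsPositive)
    {A : E →L[ℂ] E} (hA : A.IsPositive) {r : ℝ} (hr : 0 ≤ r) :
    (NormedSpace.exp ((r : ℂ) • Q) A).IsPositive := by
  have hpow : ∀ n : ℕ, ((Q ^ n) A).IsPositive := fun n => by
    induction n with
    | zero => exact hA
    | succ n ih => rw [pow_succ', mul_apply_eq_comp]; exact hQ ih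
  refine isClosed_isPositive.mem_of_tendsto
    ((hasSum_exp_smul Q r).mapL (ContinuousLinearMap.apply ℂ _ A)) (.of_forall fun s => ?_)
  refine ContinuousLinearMap.isPositive_sum _ fun n _ => ?_
  have hterm := isPositive_ofReal_smul (hpow n) (by positivity : 0 ≤ r ^ n / n.factorial)
  rw [Complex.ofReal_div, Complex.ofReal_pow, Complex.ofReal_natCast] at hterm
  exact hterm

end Positive

section Transpose

variable (E : Type*) [NormedAddCommGroup E] [InnerProductSpace ℂ E] [CompleteSpace E]

/-- The pairs `(T, T')` of bounded maps on `B(E)` such that composition with `T` preserves the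
predual and acts as `T'` on density operators, i.e. `Tr (T'(ϱ) A) = Tr (ϱ T(A))`. -/
def transposePairs : Submodule ℂ (SuperOp E × SuperOp E) where
  carrier := {p | (∀ ω ∈ predual E, ω ∘L p.1 ∈ predual E) ∧
    ∀ ω : OpDual E, dens (ω ∘L p.1) = p.2 (dens ω)}
  zero_mem' := by simp
  add_mem' {p q} hp hq := by
    refine ⟨fun ω hω => ?_, fun ω => ?_⟩
    · simpa using add_mem (hp.1 ω hω) (hq.1 ω hω)
    · simp [hp.2 ω, hq.2 ω]
  smul_mem' c p hp := by
    refine ⟨fun ω hω => ?_, fun ω => ?_⟩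
    · simpa using (predual E).smul_mem c (hp.1 ω hω)
    · simp [hp.2 ω]

theorem isClosed_transposePairs : IsClosed (transposePairs E : Set (SuperOp E × SuperOp E)) := by
  have hcomp : ∀ ω : OpDual E, Continuous fun p : SuperOp E × SuperOp E => ω ∘L p.1 :=
    fun ω => (ContinuousLinearMap.compL ℂ _ _ ℂ ω).continuous.comp continuous_fst
  have hset : (transposePairs E : Set (SuperOp E × SuperOp E)) =
      (⋂ ω ∈ predual E, {p | ω ∘L p.1 ∈ predual E}) ∩
        ⋂ ω : OpDual E, {p | dens (ω ∘L p.1) = p.2 (dens ω)} := by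
    ext p
    simp [transposePairs]
  rw [hset]
  refine (isClosed_biInter fun ω _ => isClosed_predual.preimage (hcomp ω)).inter
    (isClosed_iInter fun ω => isClosed_eq (dens.continuous.comp (hcomp ω)) (by fun_prop))

variable {E}

theorem mulLeftRight_mem_transposePairs (U V : E →L[ℂ] E) :
    (ContinuousLinearMap.mulLeftRight ℂ (E →L[ℂ] E) U V,
      ContinuousLinearMap.mulLeftRight ℂ (E →L[ℂ] E) V U) ∈ transposePairs E := by
  refine ⟨fun ω hω => comp_mem_predual (fun x y => ?_) hω, fun ω => op_ext fun x y => ?_⟩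
  · have hvec : vecFun x y ∘L ContinuousLinearMap.mulLeftRight ℂ (E →L[ℂ] E) U V =
        vecFun (U.adjoint x) (V y) := by
      ext A
      simp [ContinuousLinearMap.adjoint_inner_left]
    rw [hvec]
    exact vecFun_mem_predual _ _
  · simp only [inner_dens, ContinuousLinearMap.comp_apply,
      ContinuousLinearMap.mulLeftRight_apply, mul_apply_eq_comp]
    rw [← ContinuousLinearMap.adjoint_inner_left, inner_dens]
    congr 1
    exact op_ext fun u v => by simp [ContinuousLinearMap.adjoint_inner_left]

variable (E) in
/-- The bounded maps on `B(E)` that are their own transpose, `Tr (T(ϱ) A) = Tr (ϱ T(A))`. They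
relate the evolution of density operators to the evolution of observables. -/
def traceSymmetric : Submodule ℂ (SuperOp E) :=
  (transposePairs E).comap (LinearMap.prod .id .id)

theorem mem_traceSymmetric {T : SuperOp E} : T ∈ traceSymmetric E ↔
    (∀ ω ∈ predual E, ω ∘L T ∈ predual E) ∧ ∀ ω : OpDual E, dens (ω ∘L T) = T (dens ω) :=
  Iff.rfl

theorem isClosed_traceSymmetric : IsClosed (traceSymmetric E : Set (SuperOp E)) :=
  (isClosed_transposePairs E).preimage (continuous_id.prodMk continuous_id)

theorem one_mem_traceSymmetric : (1 : SuperOp E) ∈ traceSymmetric E :=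
  ⟨fun _ hω => hω, fun _ => rfl⟩

theorem pow_mem_traceSymmetric {T : SuperOp E} (hT : T ∈ traceSymmetric E)
    (n : ℕ) : T ^ n ∈ traceSymmetric E := by
  induction n with
  | zero => exact one_mem_traceSymmetric
  | succ n ih =>
    rw [mem_traceSymmetric] at hT ih ⊢
    refine ⟨fun ω hω => ?_, fun ω => ?_⟩
    · rw [pow_succ]
      exact hT.1 _ (ih.1 ω hω)
    · calc dens (ω ∘L T ^ (n + 1)) = dens ((ω ∘L T ^ n) ∘L T) := by rw [pow_succ]; rfl
        _ = T ((T ^ n) (dens ω)) := by rw [hT.2, ih.2]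
        _ = (T ^ (n + 1)) (dens ω) := by rw [pow_succ', mul_apply_eq_comp]

end Transpose

namespace CollisionSpec

variable {H : Type*} [NormedAddCommGroup H] [InnerProductSpace ℂ H] {ι : Type*}
  {b : HilbertBasis ι ℂ H} {h : H →ₗ.[ℂ] H}
  {C : Type*} [MetricSpace C] [CompactSpace C] [MeasurableSpace C] [BorelSpace C]
  (S : CollisionSpec b h C) {N : ℕ}

theorem UPair_eq {i j : Fin N} (hij : i ≠ j) (σ : C) :
    S.UPair hij σ = embed (pairEmb hij) (S.U σ) := pairOp_eq_embed hij _

theorem continuous_UPair {i j : Fin N} (hij : i ≠ j) : Continuous (S.UPair hij) :=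
  (continuous_pairOp hij).comp (continuous_subtype_val.comp S.continuous_U)

theorem UPair_mul_star {i j : Fin N} (hij : i ≠ j) (σ : C) :
    S.UPair hij σ * star (S.UPair hij σ) = 1 := by
  rw [UPair_eq, ← embed_star, ← embed_mul, Unitary.mul_star_self_of_mem (S.U σ).2, embed_one]

theorem norm_UPair_le {i j : Fin N} (hij : i ≠ j) (σ : C) : ‖S.UPair hij σ‖ ≤ 1 := by
  rw [UPair_eq]
  refine (norm_embed_apply_le _ _).trans ?_
  refine ContinuousLinearMap.opNorm_le_bound _ zero_le_one fun x => ?_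
  rw [one_mul]
  exact (Unitary.norm_map (S.U σ) x).le

theorem continuous_mulLeftRight_UPair {i j : Fin N} (hij : i ≠ j) :
    Continuous fun σ => ContinuousLinearMap.mulLeftRight ℂ (NOp ι N)
      (S.UPair hij σ) (star (S.UPair hij σ)) :=
  ((ContinuousLinearMap.mulLeftRight ℂ (NOp ι N)).continuous.comp
    (S.continuous_UPair hij)).clm_apply
    (continuous_star.comp (S.continuous_UPair hij))

theorem integrable_of_continuous {F : Type*} [NormedAddCommGroup F] {f : C → F}
    (hf : Continuous f) : Integrable f S.ν := by
  have := S.isProbabilityMeasure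
  exact hf.integrable_of_hasCompactSupport (.of_compactSpace _)

theorem integral_comp_of_continuous {F : Type*} [NormedAddCommGroup F] [NormedSpace ℝ F]
    {f : C → F} (hf : Continuous f) {T : C → C} (hT : MeasurePreserving T S.ν S.ν) :
    ∫ σ, f (T σ) ∂S.ν = ∫ σ, f σ ∂S.ν := by
  have hmeas := (S.integrable_of_continuous hf).aestronglyMeasurable
  rw [← hT.map_eq] at hmeas
  rw [← integral_map hT.measurable.aemeasurable hmeas, hT.map_eq]

theorem norm_QPair_apply_le {i j : Fin N} (hij : i ≠ j) (A : NOp ι N) :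
    ‖S.QPair hij A‖ ≤ ‖A‖ := by
  have := S.isProbabilityMeasure
  have hconj : ∀ σ, ‖S.UPair hij σ * A * star (S.UPair hij σ)‖ ≤ ‖A‖ := fun σ => by
    calc _ ≤ ‖S.UPair hij σ‖ * ‖A‖ * ‖star (S.UPair hij σ)‖ := norm_mul₃_le
      _ ≤ 1 * ‖A‖ * 1 := by
        rw [norm_star]
        gcongr <;> exact S.norm_UPair_le hij σ
      _ = ‖A‖ := by ring
  rw [(S.QPair_apply hij A).2]
  simpa using norm_integral_le_of_norm_le_const (μ := S.ν) (.of_forall hconj)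

theorem QPair_one {i j : Fin N} (hij : i ≠ j) : S.QPair hij 1 = 1 := by
  have := S.isProbabilityMeasure
  simp [(S.QPair_apply hij 1).2, UPair_mul_star]

theorem QPair_embed {M : ℕ} (f : Fin M ↪ Fin N) {i j : Fin M} (hij : i ≠ j)
    (hf : f i ≠ f j) (A : NOp ι M) : S.QPair hf (embed f A) = embed f (S.QPair hij A) := by
  have hU : ∀ σ, S.UPair hf σ = embed f (S.UPair hij σ) := fun σ => by
    rw [UPair_eq, UPair_eq, ← embed_trans]
    congr 2
    ext v
    fin_cases v <;> rfl
  rw [(S.QPair_apply hij _).2, (S.QPair_apply hf _).2,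
    ← ContinuousLinearMap.integral_comp_comm _ (S.QPair_apply hij A).1]
  simp only [hU, embed_mul, embed_star]

theorem QPair_mul_embed {M : ℕ} (g : Fin M ↪ Fin N) {i j : Fin N} (hij : i ≠ j)
    (hi : i ∉ Set.range g) (hj : j ∉ Set.range g) (A : NOp ι N) (B : NOp ι M) :
    S.QPair hij (A * embed g B) = S.QPair hij A * embed g B := by
  have hdisj : Disjoint (Set.range (pairEmb hij)) (Set.range g) := by
    simp [range_pairEmb, hi, hj]
  have hterm : ∀ σ, S.UPair hij σ * (A * embed g B) * star (S.UPair hij σ) =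
      (ContinuousLinearMap.mul ℂ (NOp ι N)).flip (embed g B)
        (S.UPair hij σ * A * star (S.UPair hij σ)) := fun σ => by
    rw [UPair_eq, ← embed_star, ContinuousLinearMap.flip_apply, ContinuousLinearMap.mul_apply']
    simp only [mul_assoc, (embed_comm hdisj _ B).eq]
  rw [(S.QPair_apply hij _).2, (S.QPair_apply hij _).2]
  simp only [hterm]
  exact ContinuousLinearMap.integral_comp_comm _ (S.QPair_apply hij A).1

theorem QPair_symm {i j : Fin N} (hij : i ≠ j) (hji : j ≠ i) : S.QPair hji = S.QPair hij := by
  obtain ⟨T, hT, hswap⟩ := S.swap_invariant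
  have hU : ∀ σ, S.UPair hji σ = S.UPair hij (T σ) := fun σ => by
    rw [UPair_eq, UPair_eq, ← hswap, permOp_conj, ← embed_trans]
    congr 2
    ext v
    fin_cases v <;> simp [pairEmb] <;> rfl
  rw [QPair, QPair, ← S.integral_comp_of_continuous (S.continuous_mulLeftRight_UPair hij) hT]
  simp only [hU]

/- Time reversal invariance of the collision distribution makes the averaged collision its own
transpose, so that states and observables evolve under the same semigroup. -/
theorem QPair_mem_traceSymmetric {i j : Fin N} (hij : i ≠ j) :
    S.QPair hij ∈ traceSymmetric (L2 (Fin N → ι)) := by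
  have := S.isProbabilityMeasure
  obtain ⟨T, hT, hrev⟩ := S.time_reversal
  have hU : ∀ σ, star (S.UPair hij σ) = S.UPair hij (T σ) := fun σ => by
    rw [UPair_eq, UPair_eq, ← hrev, ← embed_star]
    rfl
  have hcont := S.continuous_mulLeftRight_UPair hij
  have hcont' : Continuous fun σ => ContinuousLinearMap.mulLeftRight ℂ (NOp ι N)
      (star (S.UPair hij σ)) (S.UPair hij σ) :=
    ((ContinuousLinearMap.mulLeftRight ℂ (NOp ι N)).continuous.comp
      (continuous_star.comp (S.continuous_UPair hij))).clm_apply (S.continuous_UPair hij)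
  have hreversed : S.QPair hij = ∫ σ, ContinuousLinearMap.mulLeftRight ℂ (NOp ι N)
      (star (S.UPair hij σ)) (S.UPair hij σ) ∂S.ν := by
    rw [QPair, ← S.integral_comp_of_continuous hcont hT]
    simp only [← hU, star_star]
  have hpair : (S.QPair hij, S.QPair hij) ∈ transposePairs (L2 (Fin N → ι)) := by
    nth_rw 2 [hreversed]
    rw [QPair, ← integral_pair (S.integrable_of_continuous hcont)
      (S.integrable_of_continuous hcont')]
    exact Convex.integral_mem ((transposePairs _).restrictScalars ℝ).convex
      (isClosed_transposePairs _) (.of_forall fun σ => mulLeftRight_mem_transposePairs _ _)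
      (S.integrable_of_continuous (hcont.prodMk hcont'))
  exact hpair

theorem isPositive_QPair {i j : Fin N} (hij : i ≠ j) {A : NOp ι N} (hA : A.IsPositive) :
    (S.QPair hij A).IsPositive := by
  have := S.isProbabilityMeasure
  rw [(S.QPair_apply hij _).2]
  exact Convex.integral_mem (s := {A : NOp ι N | A.IsPositive}) convex_isPositive
    isClosed_isPositive (.of_forall fun σ => hA.conj_adjoint (S.UPair hij σ))
    (S.QPair_apply hij A).1

theorem isPositive_QN {A : NOp ι N} (hA : A.IsPositive) : (S.QN N A).IsPositive := by
  have happly : S.QN N A = (((N.choose 2 : ℝ)⁻¹ : ℝ) : ℂ) •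
      ∑ p : {p : Fin N × Fin N // p.1 < p.2}, S.QPair p.2.ne A := by
    simp [QN]
  rw [happly]
  refine isPositive_ofReal_smul ?_ (by positivity)
  exact ContinuousLinearMap.isPositive_sum _ fun p _ => S.isPositive_QPair p.2.ne hA

theorem isPositive_semigroup {A : NOp ι N} (hA : A.IsPositive) {t : ℝ} (ht : 0 ≤ t) :
    (S.semigroup N t A).IsPositive := by
  have happly : S.semigroup N t A = ((Real.exp (-(t * N)) : ℝ) : ℂ) •
      NormedSpace.exp (((t * N : ℝ) : ℂ) • S.QN N) A := by
    rw [semigroup, generator, smul_smul, exp_smul_sub_one]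
    simp
  rw [happly]
  exact isPositive_ofReal_smul (isPositive_exp_smul_apply S.isPositive_QN hA (by positivity))
    (Real.exp_pos _).le

theorem generator_mem_traceSymmetric : S.generator N ∈ traceSymmetric (L2 (Fin N → ι)) :=
  (traceSymmetric _).smul_mem _ <| sub_mem
    ((traceSymmetric _).smul_mem _ <| sum_mem fun p _ => S.QPair_mem_traceSymmetric p.2.ne)
    one_mem_traceSymmetric

theorem semigroup_mem_traceSymmetric (t : ℝ) :
    S.semigroup N t ∈ traceSymmetric (L2 (Fin N → ι)) :=
  have hsmul : (t : ℂ) • S.generator N ∈ traceSymmetric (L2 (Fin N → ι)) :=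
    Submodule.smul_mem _ _ S.generator_mem_traceSymmetric
  exp_mem_of_forall_pow_mem (isClosed_traceSymmetric (E := L2 (Fin N → ι)))
    (pow_mem_traceSymmetric hsmul)

theorem comp_semigroup_mem_predual {ω : OpDual (L2 (Fin N → ι))}
    (hω : ω ∈ predual (L2 (Fin N → ι))) (t : ℝ) :
    ω ∘L S.semigroup N t ∈ predual (L2 (Fin N → ι)) :=
  (S.semigroup_mem_traceSymmetric t).1 ω hω

theorem dens_comp_semigroup (ω : OpDual (L2 (Fin N → ι))) (t : ℝ) :
    dens (ω ∘L S.semigroup N t) = S.semigroup N t (dens ω) :=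
  (S.semigroup_mem_traceSymmetric t).2 ω

end CollisionSpec

/-! ### Generators of pair collisions -/

theorem sum_sum_eq_two_nsmul_sum_lt {M : Type*} [AddCommMonoid M] {α : Type*} [Fintype α]
    [LinearOrder α] (F : α → α → M) (hsymm : ∀ i j, F i j = F j i) (hdiag : ∀ i, F i i = 0) :
    ∑ i, ∑ j, F i j = 2 • ∑ p : {p : α × α // p.1 < p.2}, F p.1.1 p.1.2 := by
  have hsplit : ∀ p : α × α, F p.1 p.2 =
      (if p.1 < p.2 then F p.1 p.2 else 0) + (if p.2 < p.1 then F p.1 p.2 else 0) := fun p => by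
    rcases lt_trichotomy p.1 p.2 with hp | hp | hp
    · simp [hp, hp.not_gt]
    · simp [hp, hdiag]
    · simp [hp, hp.not_gt]
  have hswap : ∑ p : α × α, (if p.2 < p.1 then F p.1 p.2 else 0) =
      ∑ p : α × α, (if p.1 < p.2 then F p.1 p.2 else 0) :=
    Fintype.sum_equiv (Equiv.prodComm α α) _ _ fun p => by
      simp only [Equiv.prodComm_apply, Prod.fst_swap, Prod.snd_swap, hsymm p.2 p.1]
  rw [← Finset.sum_product', Finset.univ_product_univ,
    Finset.sum_congr rfl fun p _ => hsplit p, Finset.sum_add_distrib, hswap, two_nsmul,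
    ← Finset.sum_filter, Finset.sum_subtype (p := fun p : α × α => p.1 < p.2)
      (F := inferInstance) _ (by simp)]

theorem two_mul_card_lt (α : Type*) [Fintype α] [LinearOrder α] :
    (2 : ℂ) * Fintype.card {p : α × α // p.1 < p.2} =
      Fintype.card α * (Fintype.card α - 1) := by
  have hpairs := sum_sum_eq_two_nsmul_sum_lt (α := α) (fun i j => if i = j then (0 : ℂ) else 1)
    (fun i j => by simp only [eq_comm]) (fun i => by simp)
  have hlt : ∀ p : {p : α × α // p.1 < p.2}, (if p.1.1 = p.1.2 then (0 : ℂ) else 1) = 1 :=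
    fun p => if_neg p.2.ne
  have hrow : ∀ i : α, ∑ j, (if i = j then (0 : ℂ) else 1) = Fintype.card α - 1 := fun i => by
    have hterm : ∀ j, (if i = j then (0 : ℂ) else 1) = 1 - if i = j then 1 else 0 := fun j => by
      split_ifs <;> simp
    simp [hterm, Finset.sum_sub_distrib]
  simp only [hlt, hrow] at hpairs
  simpa [mul_sub] using hpairs.symm

theorem sum_sum_eq_of_eq_zero_off_range {M : Type*} [AddCommMonoid M] {α β : Type*} [Fintype α]
    [Fintype β] [DecidableEq β] (F : β → β → M) (hsymm : ∀ i j, F i j = F j i) (f : α ↪ β)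
    (hoff : ∀ i j, i ∉ Set.range f → j ∉ Set.range f → F i j = 0) :
    ∑ i, ∑ j, F i j = ∑ a, ∑ c, F (f a) (f c) +
      2 • ∑ j ∈ (Finset.univ.map f)ᶜ, ∑ a, F (f a) j := by
  have hsplit : ∀ G : β → M, ∑ i, G i = ∑ a, G (f a) + ∑ j ∈ (Finset.univ.map f)ᶜ, G j :=
    fun G => by
      rw [← Finset.sum_map Finset.univ f G]
      exact (Finset.sum_add_sum_compl _ _).symm
  have hrange : ∀ j ∈ (Finset.univ.map f)ᶜ, j ∉ Set.range f := fun j hj => by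
    simpa using hj
  have houter : ∀ j ∈ (Finset.univ.map f)ᶜ, ∑ i, F j i = ∑ a, F (f a) j := fun j hj => by
    rw [hsplit, Finset.sum_eq_zero fun i hi => hoff j i (hrange j hj) (hrange i hi), add_zero]
    exact Finset.sum_congr rfl fun a _ => hsymm _ _
  rw [hsplit, Finset.sum_congr rfl fun a _ => hsplit (F (f a)), Finset.sum_add_distrib,
    Finset.sum_congr rfl houter, Finset.sum_comm (s := Finset.univ) (t := (Finset.univ.map f)ᶜ),
    two_nsmul, add_assoc]

namespace CollisionSpec

variable {H : Type*} [NormedAddCommGroup H] [InnerProductSpace ℂ H] {ι : Type*}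
  {b : HilbertBasis ι ℂ H} {h : H →ₗ.[ℂ] H}
  {C : Type*} [MetricSpace C] [CompactSpace C] [MeasurableSpace C] [BorelSpace C]
  (S : CollisionSpec b h C) {N : ℕ}

/-- The generator `𝒬_{i,j} - 1` of the collisions of the particles `i` and `j`; it is `0` for
`i = j`, so that sums over pairs may include the diagonal. -/
def pairGen (i j : Fin N) : SuperOp (L2 (Fin N → ι)) :=
  if hij : i ≠ j then S.QPair hij - 1 else 0

theorem pairGen_of_ne {i j : Fin N} (hij : i ≠ j) : S.pairGen i j = S.QPair hij - 1 := dif_pos hij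

@[simp]
theorem pairGen_self (i : Fin N) : S.pairGen i i = 0 := dif_neg (by simp)

theorem pairGen_symm (i j : Fin N) : S.pairGen i j = S.pairGen j i := by
  obtain rfl | hij := eq_or_ne i j
  · rfl
  · rw [pairGen_of_ne S hij, pairGen_of_ne S hij.symm, QPair_symm]

theorem norm_pairGen_apply_le (i j : Fin N) (A : NOp ι N) : ‖S.pairGen i j A‖ ≤ 2 * ‖A‖ := by
  obtain rfl | hij := eq_or_ne i j
  · simp
  · rw [pairGen_of_ne S hij, two_mul]
    exact (norm_sub_le _ _).trans (add_le_add (S.norm_QPair_apply_le hij A) le_rfl)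

theorem pairGen_embed {M : ℕ} (f : Fin M ↪ Fin N) (i j : Fin M) (A : NOp ι M) :
    S.pairGen (f i) (f j) (embed f A) = embed f (S.pairGen i j A) := by
  obtain rfl | hij := eq_or_ne i j
  · simp
  · have hf : f i ≠ f j := f.injective.ne hij
    rw [pairGen_of_ne S hij, pairGen_of_ne S hf]
    simp [S.QPair_embed f hij hf]

theorem pairGen_mul_embed {M : ℕ} (g : Fin M ↪ Fin N) {i j : Fin N} (hi : i ∉ Set.range g)
    (hj : j ∉ Set.range g) (A : NOp ι N) (B : NOp ι M) :
    S.pairGen i j (A * embed g B) = S.pairGen i j A * embed g B := by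
  obtain rfl | hij := eq_or_ne i j
  · simp
  · rw [pairGen_of_ne S hij]
    simp [S.QPair_mul_embed g hij hi hj, sub_mul]

theorem pairGen_one (i j : Fin N) : S.pairGen i j 1 = 0 := by
  obtain rfl | hij := eq_or_ne i j
  · simp
  · rw [pairGen_of_ne S hij]
    simp [QPair_one]

theorem pairGen_embed_eq_zero {M : ℕ} (g : Fin M ↪ Fin N) {i j : Fin N} (hi : i ∉ Set.range g)
    (hj : j ∉ Set.range g) (B : NOp ι M) : S.pairGen i j (embed g B) = 0 := by
  simpa [pairGen_one] using S.pairGen_mul_embed g hi hj 1 B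

theorem generator_eq (hN : 2 ≤ N) :
    S.generator N = ((N : ℂ) - 1)⁻¹ • ∑ i, ∑ j, S.pairGen i j := by
  have hN1 : ((N : ℂ) - 1) ≠ 0 := sub_ne_zero.2 (by exact_mod_cast (by omega : N ≠ 1))
  have hN0 : (N : ℂ) ≠ 0 := by exact_mod_cast (by omega : N ≠ 0)
  have hcard := two_mul_card_lt (Fin N)
  rw [Fintype.card_fin] at hcard
  have hpair : ∀ p : {p : Fin N × Fin N // p.1 < p.2},
      S.pairGen p.1.1 p.1.2 = S.QPair p.2.ne - 1 := fun p => S.pairGen_of_ne p.2.ne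
  rw [generator, QN, sum_sum_eq_two_nsmul_sum_lt _ S.pairGen_symm S.pairGen_self,
    Finset.sum_congr rfl fun p _ => hpair p, Finset.sum_sub_distrib, Finset.sum_const,
    Finset.card_univ, Nat.cast_choose_two, ← Nat.cast_smul_eq_nsmul ℂ 2,
    ← Nat.cast_smul_eq_nsmul ℂ (Fintype.card _)]
  simp only [smul_sub, smul_smul]
  congr 2
  · push_cast; field_simp
  · push_cast
    rw [hcard]
    field_simp

theorem generator_one (hN : 2 ≤ N) : S.generator N 1 = 0 := by
  simp [generator_eq S hN, pairGen_one]

theorem commute_embed_perm_generator (hN : 2 ≤ N) (π : Equiv.Perm (Fin N)) :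
    Commute (embed π.toEmbedding : SuperOp (L2 (Fin N → ι))) (S.generator N) := by
  ext1 A
  have hpair : ∀ i j, embed π.toEmbedding (S.pairGen i j A) =
      S.pairGen (π i) (π j) (embed π.toEmbedding A) := fun i j =>
    (S.pairGen_embed π.toEmbedding i j A).symm
  rw [generator_eq S hN]
  simp only [mul_apply_eq_comp, _root_.smul_apply, sum_apply, map_smul, map_sum, hpair]
  congr 1
  rw [← Equiv.sum_comp π fun i => ∑ j, S.pairGen i j (embed π.toEmbedding A)]
  exact Finset.sum_congr rfl fun i _ =>
    Equiv.sum_comp π fun j => S.pairGen (π i) j (embed π.toEmbedding A)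

theorem commute_embed_perm_semigroup (hN : 2 ≤ N) (π : Equiv.Perm (Fin N)) (t : ℝ) :
    Commute (embed π.toEmbedding : SuperOp (L2 (Fin N → ι))) (S.semigroup N t) :=
  ((S.commute_embed_perm_generator hN π).smul_right (t : ℂ)).exp_right

theorem hasSum_comp_semigroup {G : Type*} [NormedAddCommGroup G] [NormedSpace ℂ G] (t : ℝ)
    (T : NOp ι N →L[ℂ] G) :
    HasSum (fun n : ℕ => ((t : ℂ) ^ n / n.factorial) • (T ∘L (S.generator N ^ n)))
      (T ∘L S.semigroup N t) :=
  ((hasSum_exp_smul (S.generator N) t).mapL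
    (ContinuousLinearMap.compL ℂ (NOp ι N) (NOp ι N) G T)).congr_fun fun n => by simp

theorem semigroup_one (hN : 2 ≤ N) (t : ℝ) : S.semigroup N t 1 = 1 := by
  refine ((hasSum_exp_smul (S.generator N) t).mapL
    (ContinuousLinearMap.apply ℂ (NOp ι N) 1)).unique ?_
  have hpow : ∀ n : ℕ, n ≠ 0 → (S.generator N ^ n) 1 = 0 := fun n hn => by
    obtain ⟨m, rfl⟩ := Nat.exists_eq_succ_of_ne_zero hn
    rw [Nat.succ_eq_add_one, pow_succ, mul_apply_eq_comp, generator_one S hN, map_zero]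
  simpa using hasSum_single (f := fun n : ℕ =>
    ((t : ℂ) ^ n / n.factorial) • (S.generator N ^ n) 1) 0 fun n hn => by rw [hpow n hn, smul_zero]

theorem semigroup_add (s t : ℝ) (A : NOp ι N) :
    S.semigroup N (s + t) A = S.semigroup N s (S.semigroup N t A) := by
  rw [semigroup, Complex.ofReal_add, exp_add_smul]
  rfl

theorem semigroup_zero (A : NOp ι N) : S.semigroup N 0 A = A := by
  rw [semigroup, Complex.ofReal_zero, zero_smul, NormedSpace.exp_zero]
  rfl

end CollisionSpec

section Reduced

variable {ι : Type*}

/-- The `k`-particle marginal of a functional on the `N`-particle operators, with the junk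
value `0` for `N < k`. -/
def reduced (k : ℕ) {N : ℕ} (ω : OpDual (L2 (Fin N → ι))) : OpDual (L2 (Fin k → ι)) :=
  if h : k ≤ N then ω ∘L embed (Fin.castLEEmb h) else 0

theorem reduced_of_le {k N : ℕ} (h : k ≤ N) (ω : OpDual (L2 (Fin N → ι))) :
    reduced k ω = ω ∘L embed (Fin.castLEEmb h) := dif_pos h

theorem reduced_of_lt {k N : ℕ} (h : N < k) (ω : OpDual (L2 (Fin N → ι))) : reduced k ω = 0 :=
  dif_neg h.not_ge

theorem norm_comp_embed_le {V W : Type*} (f : V ↪ W) (ω : OpDual (L2 (W → ι))) :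
    ‖ω ∘L embed f‖ ≤ ‖ω‖ :=
  (ContinuousLinearMap.opNorm_comp_le _ _).trans <|
    mul_le_of_le_one_right (norm_nonneg _) (norm_embed_le f)

theorem norm_reduced_le (k : ℕ) {N : ℕ} (ω : OpDual (L2 (Fin N → ι))) :
    ‖reduced k ω‖ ≤ ‖ω‖ := by
  obtain h | h := le_or_gt k N
  · rw [reduced_of_le h]
    exact norm_comp_embed_le _ _
  · rw [reduced_of_lt h, norm_zero]
    exact norm_nonneg _

/-- Functionals on the `N`-particle operators that are invariant under all permutations of the
particles. -/
def IsSymmFun {N : ℕ} (ω : OpDual (L2 (Fin N → ι))) : Prop :=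
  ∀ π : Equiv.Perm (Fin N), ω ∘L embed π.toEmbedding = ω

theorem exists_perm_trans_eq {α β : Type*} [Finite β] (f g : α ↪ β) :
    ∃ π : Equiv.Perm β, g.trans π.toEmbedding = f := by
  classical
  let e : {x // x ∈ Set.range g} ≃ {x // x ∈ Set.range f} :=
    (Equiv.ofInjective g g.injective).symm.trans (Equiv.ofInjective f f.injective)
  refine ⟨e.extendSubtype, ?_⟩
  ext v
  have hv : e ⟨g v, v, rfl⟩ = ⟨f v, v, rfl⟩ :=
    congrArg (Equiv.ofInjective f f.injective)
      ((Equiv.ofInjective g g.injective).symm_apply_apply v)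
  simp [e.extendSubtype_apply_of_mem _ ⟨v, rfl⟩, hv]

theorem IsSymmFun.comp_of_commute {N : ℕ} {ω : OpDual (L2 (Fin N → ι))} (hω : IsSymmFun ω)
    {T : SuperOp (L2 (Fin N → ι))}
    (hT : ∀ π : Equiv.Perm (Fin N), Commute (embed π.toEmbedding) T) : IsSymmFun (ω ∘L T) :=
  fun π => calc
    (ω ∘L T) ∘L embed π.toEmbedding = ω ∘L (T * embed π.toEmbedding) := rfl
    _ = (ω ∘L embed π.toEmbedding) ∘L T := by rw [← (hT π).eq]; rfl
    _ = ω ∘L T := by rw [hω π]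

theorem IsSymmFun.comp_embed {k N : ℕ} {ω : OpDual (L2 (Fin N → ι))} (hω : IsSymmFun ω)
    (f : Fin k ↪ Fin N) : ω ∘L embed f = reduced k ω := by
  have hk : k ≤ N := by simpa using Fintype.card_le_of_embedding f
  obtain ⟨π, rfl⟩ := exists_perm_trans_eq f (Fin.castLEEmb hk)
  rw [reduced_of_le hk]
  nth_rw 2 [← hω π]
  ext A
  exact congrArg ω (embed_trans _ _ A)

theorem IsSymmFun.reduced_comp_embed {k n N : ℕ} {ω : OpDual (L2 (Fin N → ι))}
    (hω : IsSymmFun ω) (hn : n ≤ N) (f : Fin k ↪ Fin n) :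
    reduced n ω ∘L embed f = reduced k ω := by
  rw [reduced_of_le hn, ← hω.comp_embed (f.trans (Fin.castLEEmb hn))]
  ext A
  exact congrArg ω (embed_trans _ _ _).symm

end Reduced

/-! ### The hierarchy of marginals -/

theorem tendsto_inv_natCast_sub_one : Tendsto (fun N : ℕ => ((N : ℂ) - 1)⁻¹) atTop (𝓝 0) := by
  have hbound : ∀ N : ℕ, (N : ℝ) + -1 ≤ ‖(N : ℂ) - 1‖ := fun N => by
    simpa using norm_sub_norm_le (N : ℂ) 1
  refine tendsto_inv₀_cobounded.comp (tendsto_norm_atTop_iff_cobounded.1 ?_)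
  exact tendsto_atTop_mono hbound
    (tendsto_atTop_add_const_right atTop (-1 : ℝ) tendsto_natCast_atTop_atTop)

theorem tendsto_inv_sub_one_mul_two_mul_sub (k : ℕ) :
    Tendsto (fun N : ℕ => ((N : ℂ) - 1)⁻¹ * (2 * ((N - k : ℕ) : ℂ))) atTop (𝓝 2) := by
  have hlim : Tendsto (fun N : ℕ => 2 + ((N : ℂ) - 1)⁻¹ * (2 - 2 * k)) atTop (𝓝 2) := by
    simpa using tendsto_const_nhds.add (tendsto_inv_natCast_sub_one.mul_const (2 - 2 * (k : ℂ)))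
  refine hlim.congr' ?_
  filter_upwards [eventually_ge_atTop (max 2 k)] with N hN
  have hN1 : ((N : ℂ) - 1) ≠ 0 := sub_ne_zero.2 (by exact_mod_cast (by omega : N ≠ 1))
  rw [Nat.cast_sub (by omega)]
  field_simp
  ring

/-- The extension of an embedding of `k` particles by one particle outside of its range. -/
def snocEmb {k N : ℕ} (f : Fin k ↪ Fin N) (j : Fin N) (hj : j ∉ Set.range f) :
    Fin (k + 1) ↪ Fin N where
  toFun := Fin.snoc f j
  inj' := Fin.snoc_injective_iff.2 ⟨f.injective, hj⟩

theorem snocEmb_castSucc {k N : ℕ} (f : Fin k ↪ Fin N) {j : Fin N} (hj : j ∉ Set.range f)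
    (a : Fin k) : snocEmb f j hj a.castSucc = f a := Fin.snoc_castSucc (α := fun _ => Fin N) j f a

theorem snocEmb_last {k N : ℕ} (f : Fin k ↪ Fin N) {j : Fin N} (hj : j ∉ Set.range f) :
    snocEmb f j hj (Fin.last k) = j := Fin.snoc_last (α := fun _ => Fin N) j f

namespace CollisionSpec

variable {H : Type*} [NormedAddCommGroup H] [InnerProductSpace ℂ H] {ι : Type*}
  {b : HilbertBasis ι ℂ H} {h : H →ₗ.[ℂ] H}
  {C : Type*} [MetricSpace C] [CompactSpace C] [MeasurableSpace C] [BorelSpace C]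
  (S : CollisionSpec b h C) {N : ℕ}

/-- The unnormalised generator of the collisions among `k` particles; every pair is counted
twice. -/
def innerGen (k : ℕ) : SuperOp (L2 (Fin k → ι)) := ∑ a, ∑ c, S.pairGen a c

/-- The unnormalised generator of the collisions of `k` particles with one further particle. -/
def outerGen (k : ℕ) : NOp ι k →L[ℂ] NOp ι (k + 1) :=
  ∑ a : Fin k, S.pairGen a.castSucc (Fin.last k) ∘L embed Fin.castSuccEmb

theorem outerGen_apply (k : ℕ) (A : NOp ι k) :
    S.outerGen k A =
      ∑ a : Fin k, S.pairGen a.castSucc (Fin.last k) (embed Fin.castSuccEmb A) := by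
  simp [outerGen]

theorem norm_innerGen_le (k : ℕ) : ‖S.innerGen k‖ ≤ 2 * (k : ℝ) ^ 2 := by
  refine ContinuousLinearMap.opNorm_le_bound _ (by positivity) fun A => ?_
  calc ‖S.innerGen k A‖ = ‖∑ a, ∑ c, S.pairGen a c A‖ := by simp [innerGen]
    _ ≤ ∑ _a : Fin k, ∑ _c : Fin k, 2 * ‖A‖ := norm_sum_le_of_le _ fun a _ =>
        norm_sum_le_of_le _ fun c _ => S.norm_pairGen_apply_le a c A
    _ = 2 * (k : ℝ) ^ 2 * ‖A‖ := by simp; ring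

theorem norm_outerGen_le (k : ℕ) : ‖S.outerGen k‖ ≤ 2 * (k : ℝ) := by
  refine ContinuousLinearMap.opNorm_le_bound _ (by positivity) fun A => ?_
  calc ‖S.outerGen k A‖ ≤ ∑ _a : Fin k, 2 * ‖A‖ := by
        rw [outerGen_apply]
        exact norm_sum_le_of_le _ fun a _ => (S.norm_pairGen_apply_le _ _ _).trans
          (by gcongr; exact norm_embed_apply_le _ A)
    _ = 2 * (k : ℝ) * ‖A‖ := by simp; ring

theorem sum_sum_pairGen_embed {k : ℕ} (f : Fin k ↪ Fin N) (A : NOp ι k) :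
    ∑ a, ∑ c, S.pairGen (f a) (f c) (embed f A) = embed f (S.innerGen k A) := by
  simp [innerGen, pairGen_embed]

theorem sum_pairGen_embed {k : ℕ} (f : Fin k ↪ Fin N) {j : Fin N} (hj : j ∉ Set.range f)
    (A : NOp ι k) :
    ∑ a, S.pairGen (f a) j (embed f A) = embed (snocEmb f j hj) (S.outerGen k A) := by
  have hf : Fin.castSuccEmb.trans (snocEmb f j hj) = f := by
    ext1 a
    exact snocEmb_castSucc f hj a
  rw [outerGen_apply, map_sum]
  refine Finset.sum_congr rfl fun a _ => ?_
  rw [← pairGen_embed, ← embed_trans, hf, snocEmb_castSucc, snocEmb_last]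

theorem reduced_comp_generator (hN : 2 ≤ N) {k : ℕ} (hk : k ≤ N)
    {ω : OpDual (L2 (Fin N → ι))} (hω : IsSymmFun ω) :
    reduced k (ω ∘L S.generator N) = ((N : ℂ) - 1)⁻¹ •
      (reduced k ω ∘L S.innerGen k +
        (2 * ((N - k : ℕ) : ℂ)) • (reduced (k + 1) ω ∘L S.outerGen k)) := by
  ext A
  set f : Fin k ↪ Fin N := Fin.castLEEmb hk
  have houter : ∀ j ∈ (Finset.univ.map f)ᶜ,
      ω (∑ a, S.pairGen (f a) j (embed f A)) = reduced (k + 1) ω (S.outerGen k A) := by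
    intro j hj
    have hj' : j ∉ Set.range f := by simpa using hj
    rw [sum_pairGen_embed S f hj', ← hω.comp_embed (snocEmb f j hj')]
    rfl
  have hinner : ω (embed f (S.innerGen k A)) = reduced k ω (S.innerGen k A) := by
    rw [reduced_of_le hk]
    rfl
  have hcard : ((Finset.univ.map f)ᶜ).card = N - k := by simp [Finset.card_compl]
  have hsplit := sum_sum_eq_of_eq_zero_off_range (fun i j => S.pairGen i j (embed f A))
    (fun i j => by rw [pairGen_symm]) f
    fun i j hi hj => S.pairGen_embed_eq_zero f hi hj A
  calc reduced k (ω ∘L S.generator N) A = ω (S.generator N (embed f A)) := by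
        rw [reduced_of_le hk]
        rfl
    _ = ω (((N : ℂ) - 1)⁻¹ • ∑ i, ∑ j, S.pairGen i j (embed f A)) := by
        simp [generator_eq S hN]
    _ = ((N : ℂ) - 1)⁻¹ • (reduced k ω (S.innerGen k A) +
          2 • (N - k) • reduced (k + 1) ω (S.outerGen k A)) := by
        rw [hsplit, sum_sum_pairGen_embed, map_smul, map_add, map_nsmul, map_sum,
          Finset.sum_congr rfl houter, Finset.sum_const, hcard, hinner]
    _ = _ := by simp [mul_add, mul_assoc]

theorem norm_reduced_comp_generator_le (hN : 2 ≤ N) {ω : OpDual (L2 (Fin N → ι))}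
    (hω : IsSymmFun ω) {k : ℕ} {a : ℝ} (hk : ‖reduced k ω‖ ≤ a) (hk1 : ‖reduced (k + 1) ω‖ ≤ a) :
    ‖reduced k (ω ∘L S.generator N)‖ ≤ 8 * k * a := by
  have ha : 0 ≤ a := (norm_nonneg _).trans hk
  obtain hkN | hkN := lt_or_ge N k
  · rw [reduced_of_lt hkN, norm_zero]
    positivity
  have hN2 : (2 : ℝ) ≤ N := by exact_mod_cast hN
  have hN1 : (0 : ℝ) < N - 1 := by linarith
  have hNk : (0 : ℝ) ≤ N - k := sub_nonneg.2 (by exact_mod_cast hkN)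
  have hinv : ‖((N : ℂ) - 1)⁻¹‖ = ((N : ℝ) - 1)⁻¹ := by
    rw [norm_inv, ← Complex.ofReal_natCast, ← Complex.ofReal_one, ← Complex.ofReal_sub,
      Complex.norm_real, Real.norm_of_nonneg hN1.le]
  have hsub : ‖(2 * ((N - k : ℕ) : ℂ))‖ = 2 * ((N : ℝ) - k) := by
    rw [norm_mul, Complex.norm_natCast, Nat.cast_sub hkN, Complex.norm_ofNat]
  rw [S.reduced_comp_generator hN hkN hω, norm_smul, hinv, inv_mul_le_iff₀ hN1]
  calc _ ≤ ‖reduced k ω‖ * ‖S.innerGen k‖ +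
        2 * ((N : ℝ) - k) * (‖reduced (k + 1) ω‖ * ‖S.outerGen k‖) := by
        refine (norm_add_le _ _).trans
          (add_le_add (ContinuousLinearMap.opNorm_comp_le _ _) ?_)
        rw [norm_smul, hsub]
        gcongr
        exact ContinuousLinearMap.opNorm_comp_le _ _
    _ ≤ a * (2 * (k : ℝ) ^ 2) + 2 * ((N : ℝ) - k) * (a * (2 * k)) := by
        gcongr
        · exact S.norm_innerGen_le k
        · exact S.norm_outerGen_le k
    _ = k * a * (4 * N - 2 * k) := by ring
    _ ≤ k * a * (8 * (N - 1)) := by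
        gcongr
        linarith [(Nat.cast_nonneg k : (0 : ℝ) ≤ k)]
    _ = ((N : ℝ) - 1) * (8 * k * a) := by ring

theorem comp_generator_pow_succ {G : Type*} [NormedAddCommGroup G] [NormedSpace ℂ G]
    (T : NOp ι N →L[ℂ] G) (j : ℕ) :
    T ∘L (S.generator N ^ (j + 1)) = (T ∘L (S.generator N ^ j)) ∘L S.generator N := by
  rw [pow_succ]
  rfl

theorem isSymmFun_comp_generator_pow (hN : 2 ≤ N) {ω : OpDual (L2 (Fin N → ι))}
    (hω : IsSymmFun ω) (n : ℕ) : IsSymmFun (ω ∘L (S.generator N ^ n)) :=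
  hω.comp_of_commute fun π => (S.commute_embed_perm_generator hN π).pow_right n

theorem norm_reduced_comp_generator_pow_le (hN : 2 ≤ N) {ω : OpDual (L2 (Fin N → ι))}
    (hω : IsSymmFun ω) (hnorm : ‖ω‖ ≤ 1) (j k : ℕ) :
    ‖reduced k (ω ∘L (S.generator N ^ j))‖ ≤ 8 ^ j * (k.ascFactorial j : ℝ) := by
  induction j generalizing k with
  | zero => simpa using! (norm_reduced_le k ω).trans hnorm
  | succ j ih =>
    have hasc : (k : ℝ) * ((k + 1).ascFactorial j : ℝ) = (k.ascFactorial (j + 1) : ℝ) := by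
      rw [Nat.ascFactorial_succ, ← Nat.succ_ascFactorial k j]
      push_cast
      rfl
    have hmono : (k.ascFactorial j : ℝ) ≤ ((k + 1).ascFactorial j : ℝ) := by
      exact_mod_cast Nat.ascFactorial_le j k.le_succ
    rw [comp_generator_pow_succ]
    calc _ ≤ 8 * k * (8 ^ j * ((k + 1).ascFactorial j : ℝ)) :=
          S.norm_reduced_comp_generator_le hN (S.isSymmFun_comp_generator_pow hN hω j)
            ((ih k).trans (by gcongr)) (ih (k + 1))
      _ = 8 ^ (j + 1) * (k.ascFactorial (j + 1) : ℝ) := by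
          rw [← hasc]
          ring

/-- The `j`-th derivative at time `0` of the `k`-particle marginal of the solution of the limiting
hierarchy with initial marginals `τ`; only collisions with further particles survive the limit. -/
def limitTerm (τ : (k : ℕ) → OpDual (L2 (Fin k → ι))) : ℕ → (k : ℕ) → OpDual (L2 (Fin k → ι))
  | 0, k => τ k
  | j + 1, k => (2 : ℂ) • (limitTerm τ j (k + 1) ∘L S.outerGen k)

theorem tendsto_reduced_comp_generator_pow {φ : (N : ℕ) → OpDual (L2 (Fin N → ι))}
    {τ : (k : ℕ) → OpDual (L2 (Fin k → ι))} (hφ : ∀ N, 2 ≤ N → IsSymmFun (φ N))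
    (hτ : ∀ k, 1 ≤ k → Tendsto (fun N => reduced k (φ N)) atTop (𝓝 (τ k))) (j k : ℕ)
    (hk : 1 ≤ k) :
    Tendsto (fun N => reduced k (φ N ∘L (S.generator N ^ j))) atTop (𝓝 (S.limitTerm τ j k)) := by
  induction j generalizing k with
  | zero => exact hτ k hk
  | succ j ih =>
    have cinner : Continuous fun ω : OpDual (L2 (Fin k → ι)) => ω ∘L S.innerGen k := by fun_prop
    have couter : Continuous fun ω : OpDual (L2 (Fin (k + 1) → ι)) => ω ∘L S.outerGen k := by
      fun_prop
    have hinner := tendsto_inv_natCast_sub_one.smul ((cinner.tendsto _).comp (ih k hk))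
    have houter := (tendsto_inv_sub_one_mul_two_mul_sub k).smul
      ((couter.tendsto _).comp (ih (k + 1) (by omega)))
    have hsum := hinner.add houter
    rw [zero_smul, zero_add] at hsum
    refine hsum.congr' ?_
    filter_upwards [eventually_ge_atTop (max 2 k)] with N hN
    rw [comp_generator_pow_succ, S.reduced_comp_generator (by omega) (by omega)
      (S.isSymmFun_comp_generator_pow (by omega) (hφ N (by omega)) j), smul_add, smul_smul]
    rfl

end CollisionSpec

/-! ### Propagation of product families -/

theorem sum_eq_add_of_eq_zero_off_ranges {M : Type*} [AddCommMonoid M] {α β γ : Type*} [Fintype α]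
    [Fintype β] [Fintype γ] (F : γ → M) {f : α ↪ γ} {g : β ↪ γ}
    (hfg : Disjoint (Set.range f) (Set.range g))
    (hoff : ∀ i, i ∉ Set.range f → i ∉ Set.range g → F i = 0) :
    ∑ i, F i = ∑ a, F (f a) + ∑ c, F (g c) := by
  classical
  have hdisj : Disjoint (Finset.univ.map f) (Finset.univ.map g) := by
    rw [← Finset.disjoint_coe]
    simpa using hfg
  rw [← Finset.sum_map Finset.univ f F, ← Finset.sum_map Finset.univ g F,
    ← Finset.sum_union hdisj]
  refine (Finset.sum_subset (Finset.subset_univ _) fun i _ hi => ?_).symm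
  exact hoff i (fun hf => hi (by simp_all)) (fun hg => hi (by simp_all))

theorem tsum_pow_div_factorial_mul {x y : ℕ → ℂ} {t : ℂ}
    (hx : Summable fun j : ℕ => t ^ j / j.factorial * x j)
    (hy : Summable fun j : ℕ => t ^ j / j.factorial * y j) :
    (∑' j : ℕ, t ^ j / j.factorial * x j) * ∑' j : ℕ, t ^ j / j.factorial * y j =
      ∑' j : ℕ, t ^ j / j.factorial *
        ∑ p ∈ Finset.HasAntidiagonal.antidiagonal j, (j.choose p.1 : ℂ) * (x p.1 * y p.2) := by
  rw [tsum_mul_tsum_eq_tsum_sum_antidiagonal_of_summable_norm hx.norm hy.norm]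
  refine tsum_congr fun j => ?_
  rw [Finset.mul_sum]
  refine Finset.sum_congr rfl fun p hp => ?_
  obtain ⟨i, i'⟩ := p
  obtain rfl := Finset.HasAntidiagonal.mem_antidiagonal.1 hp
  have hchoose : ((i + i').factorial : ℂ) =
      ((i + i').choose i : ℂ) * i.factorial * i'.factorial := by
    rw [Nat.choose_symm_add]
    exact_mod_cast (Nat.add_choose_mul_factorial_mul_factorial i i').symm
  have hne : ((i + i').choose i : ℂ) ≠ 0 := by
    exact_mod_cast (Nat.choose_pos (Nat.le_add_right i i')).ne'
  have hi : (i.factorial : ℂ) ≠ 0 := by exact_mod_cast i.factorial_ne_zero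
  have hi' : (i'.factorial : ℂ) ≠ 0 := by exact_mod_cast i'.factorial_ne_zero
  simp only [hchoose]
  field_simp
  ring

theorem ascFactorial_div_factorial_le {k : ℕ} (hk : 1 ≤ k) (j : ℕ) :
    (k.ascFactorial j : ℝ) / (j.factorial : ℝ) ≤ 2 ^ k * 2 ^ j := by
  rw [div_le_iff₀ (by positivity), Nat.ascFactorial_eq_factorial_mul_choose', Nat.cast_mul,
    mul_comm (2 ^ k * 2 ^ j : ℝ), ← pow_add]
  gcongr
  exact_mod_cast (Nat.choose_le_two_pow _ _).trans (Nat.pow_le_pow_right (by norm_num) (by omega))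

theorem norm_pow_div_factorial_smul_le {F : Type*} [NormedAddCommGroup F] [NormedSpace ℂ F] {x : F}
    {c t : ℝ} (hc : 0 ≤ c) (ht : 0 ≤ t) {j k : ℕ} (hk : 1 ≤ k)
    (hx : ‖x‖ ≤ c ^ j * (k.ascFactorial j : ℝ)) :
    ‖((t : ℂ) ^ j / (j.factorial : ℂ)) • x‖ ≤ 2 ^ k * (2 * c * t) ^ j := by
  rw [norm_smul, norm_div, norm_pow, Complex.norm_real, Real.norm_of_nonneg ht,
    Complex.norm_natCast]
  calc t ^ j / j.factorial * ‖x‖ ≤ t ^ j / j.factorial * (c ^ j * (k.ascFactorial j : ℝ)) := by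
        gcongr
    _ = (c * t) ^ j * ((k.ascFactorial j : ℝ) / (j.factorial : ℝ)) := by
        rw [mul_pow]
        ring
    _ ≤ (c * t) ^ j * (2 ^ k * 2 ^ j) := by
        gcongr
        exact ascFactorial_div_factorial_le hk j
    _ = 2 ^ k * (2 * c * t) ^ j := by
        rw [mul_assoc 2, mul_pow 2]
        ring

/-- The families of functionals that factorise over products of operators acting on disjoint
nonempty sets of particles. -/
def IsProductFamily {ι : Type*} (τ : (k : ℕ) → OpDual (L2 (Fin k → ι))) : Prop :=
  ∀ (k l n : ℕ) (f : Fin k ↪ Fin n) (g : Fin l ↪ Fin n), 1 ≤ k → 1 ≤ l →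
    Disjoint (Set.range f) (Set.range g) →
      ∀ A B, τ n (embed f A * embed g B) = τ k A * τ l B

theorem castSucc_notMem_range_trans {k n : ℕ} {f : Fin k ↪ Fin n} {i : Fin n}
    (hi : i ∉ Set.range f) : i.castSucc ∉ Set.range (f.trans Fin.castSuccEmb) :=
  fun ⟨v, hv⟩ => hi ⟨v, Fin.castSucc_injective n hv⟩

theorem last_notMem_range_trans {k n : ℕ} (f : Fin k ↪ Fin n) :
    Fin.last n ∉ Set.range (f.trans Fin.castSuccEmb) :=
  fun ⟨v, hv⟩ => (Fin.castSucc_lt_last (f v)).ne hv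

/-- The embedding `f` extended by sending one further particle to one further particle. -/
def succEmb {k n : ℕ} (f : Fin k ↪ Fin n) : Fin (k + 1) ↪ Fin (n + 1) :=
  snocEmb (f.trans Fin.castSuccEmb) (Fin.last n) (last_notMem_range_trans f)

theorem succEmb_castSucc {k n : ℕ} (f : Fin k ↪ Fin n) (a : Fin k) :
    succEmb f a.castSucc = (f a).castSucc := snocEmb_castSucc _ _ a

theorem succEmb_last {k n : ℕ} (f : Fin k ↪ Fin n) : succEmb f (Fin.last k) = Fin.last n :=
  snocEmb_last _ _

theorem castSuccEmb_trans_succEmb {k n : ℕ} (f : Fin k ↪ Fin n) :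
    Fin.castSuccEmb.trans (succEmb f) = f.trans Fin.castSuccEmb := by
  ext1 a
  exact succEmb_castSucc f a

theorem disjoint_range_succEmb {k l n : ℕ} {f : Fin k ↪ Fin n} {g : Fin l ↪ Fin n}
    (hfg : Disjoint (Set.range f) (Set.range g)) :
    Disjoint (Set.range (succEmb f)) (Set.range (g.trans Fin.castSuccEmb)) := by
  rw [Set.disjoint_left]
  rintro _ ⟨v, rfl⟩
  refine Fin.lastCases ?_ (fun a => ?_) v
  · rw [succEmb_last]
    exact last_notMem_range_trans g
  · rw [succEmb_castSucc]
    exact castSucc_notMem_range_trans (Set.disjoint_left.1 hfg ⟨a, rfl⟩)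

namespace CollisionSpec

variable {H : Type*} [NormedAddCommGroup H] [InnerProductSpace ℂ H] {ι : Type*}
  {b : HilbertBasis ι ℂ H} {h : H →ₗ.[ℂ] H}
  {C : Type*} [MetricSpace C] [CompactSpace C] [MeasurableSpace C] [BorelSpace C]
  (S : CollisionSpec b h C) {N : ℕ}

theorem sum_pairGen_embed_mul_embed {k l n : ℕ} {f : Fin k ↪ Fin n} {g : Fin l ↪ Fin n}
    (hfg : Disjoint (Set.range f) (Set.range g)) (A : NOp ι k) (B : NOp ι l) :
    ∑ a, S.pairGen (f a).castSucc (Fin.last n) (embed Fin.castSuccEmb (embed f A * embed g B)) =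
      embed (succEmb f) (S.outerGen k A) * embed (g.trans Fin.castSuccEmb) B := by
  rw [outerGen_apply, map_sum, Finset.sum_mul]
  refine Finset.sum_congr rfl fun a _ => ?_
  rw [embed_mul, ← embed_trans, ← embed_trans,
    pairGen_mul_embed S _ (castSucc_notMem_range_trans (Set.disjoint_left.1 hfg ⟨a, rfl⟩))
      (last_notMem_range_trans g), ← pairGen_embed, ← embed_trans, castSuccEmb_trans_succEmb,
    succEmb_castSucc, succEmb_last]

/- The Leibniz rule behind the propagation of chaos: the further particle collides either with
the particles of `A` or with those of `B`. -/
theorem outerGen_mul {k l n : ℕ} {f : Fin k ↪ Fin n} {g : Fin l ↪ Fin n}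
    (hfg : Disjoint (Set.range f) (Set.range g)) (A : NOp ι k) (B : NOp ι l) :
    S.outerGen n (embed f A * embed g B) =
      embed (succEmb f) (S.outerGen k A) * embed (g.trans Fin.castSuccEmb) B +
        embed (f.trans Fin.castSuccEmb) A * embed (succEmb g) (S.outerGen l B) := by
  have hg := S.sum_pairGen_embed_mul_embed hfg.symm B A
  rw [(embed_comm hfg.symm B A).eq, (embed_comm (disjoint_range_succEmb hfg.symm) _ A).eq] at hg
  rw [outerGen_apply, sum_eq_add_of_eq_zero_off_ranges _ hfg fun i hf hg => ?_,
    S.sum_pairGen_embed_mul_embed hfg A B, hg]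
  rw [embed_mul, ← embed_trans, ← embed_trans,
    pairGen_mul_embed S _ (castSucc_notMem_range_trans hg) (last_notMem_range_trans g),
    pairGen_embed_eq_zero S _ (castSucc_notMem_range_trans hf) (last_notMem_range_trans f),
    zero_mul]

theorem limitTerm_mul {τ : (k : ℕ) → OpDual (L2 (Fin k → ι))} (hτ : IsProductFamily τ)
    (j : ℕ) {k l n : ℕ} (f : Fin k ↪ Fin n) (g : Fin l ↪ Fin n) (hk : 1 ≤ k) (hl : 1 ≤ l)
    (hfg : Disjoint (Set.range f) (Set.range g)) (A : NOp ι k) (B : NOp ι l) :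
    S.limitTerm τ j n (embed f A * embed g B) = ∑ p ∈ Finset.HasAntidiagonal.antidiagonal j,
      (j.choose p.1 : ℂ) * (S.limitTerm τ p.1 k A * S.limitTerm τ p.2 l B) := by
  induction j generalizing k l n with
  | zero => simpa [limitTerm] using hτ k l n f g hk hl hfg A B
  | succ j ih =>
    have hf := ih (succEmb f) (g.trans Fin.castSuccEmb) (by omega) hl
      (disjoint_range_succEmb hfg) (S.outerGen k A) B
    have hg := ih (f.trans Fin.castSuccEmb) (succEmb g) hk (by omega)
      (disjoint_range_succEmb hfg.symm).symm A (S.outerGen l B)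
    have hsucc : ∀ i q (D : NOp ι q), S.limitTerm τ (i + 1) q D =
        2 * S.limitTerm τ i (q + 1) (S.outerGen q D) := fun i q D => rfl
    rw [Finset.sum_antidiagonal_choose_succ_mul
      (fun i i' => S.limitTerm τ i k A * S.limitTerm τ i' l B), hsucc, outerGen_mul S hfg, map_add,
      hf, hg, mul_add, Finset.mul_sum, Finset.mul_sum, add_comm]
    congr 1
    · refine Finset.sum_congr rfl fun p _ => ?_
      rw [hsucc]
      ring
    · refine Finset.sum_congr rfl fun p hp => ?_
      rw [hsucc, ← Finset.HasAntidiagonal.mem_antidiagonal.1 hp, Nat.choose_symm_add]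
      ring

theorem norm_limitTerm_le {τ : (k : ℕ) → OpDual (L2 (Fin k → ι))} (hτ : ∀ k, 1 ≤ k → ‖τ k‖ ≤ 1)
    (j : ℕ) {k : ℕ} (hk : 1 ≤ k) : ‖S.limitTerm τ j k‖ ≤ 4 ^ j * (k.ascFactorial j : ℝ) := by
  induction j generalizing k with
  | zero => simpa [limitTerm] using! hτ k hk
  | succ j ih =>
    calc ‖S.limitTerm τ (j + 1) k‖ ≤ 2 * (‖S.limitTerm τ j (k + 1)‖ * ‖S.outerGen k‖) := by
          rw [limitTerm, norm_smul, Complex.norm_ofNat]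
          gcongr
          exact ContinuousLinearMap.opNorm_comp_le _ _
      _ ≤ 2 * (4 ^ j * ((k + 1).ascFactorial j : ℝ) * (2 * k)) := by
          gcongr
          · exact ih (by omega)
          · exact S.norm_outerGen_le k
      _ = 4 ^ (j + 1) * (k * ((k + 1).ascFactorial j : ℝ)) := by ring
      _ = 4 ^ (j + 1) * (k.ascFactorial (j + 1) : ℝ) := by
          rw [Nat.ascFactorial_succ, ← Nat.succ_ascFactorial k j]
          push_cast
          rfl

/-- The `k`-particle marginal at time `t` of the solution of the limiting hierarchy with initial
marginals `τ`, given by its power series, which converges for small `t`. -/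
def limitFun (τ : (k : ℕ) → OpDual (L2 (Fin k → ι))) (t : ℝ) (k : ℕ) : OpDual (L2 (Fin k → ι)) :=
  ∑' j : ℕ, ((t : ℂ) ^ j / (j.factorial : ℂ)) • S.limitTerm τ j k

theorem hasSum_limitFun_apply {τ : (k : ℕ) → OpDual (L2 (Fin k → ι))}
    (hτ : ∀ k, 1 ≤ k → ‖τ k‖ ≤ 1) {t : ℝ} (ht : 0 ≤ t) (ht' : 8 * t < 1) {k : ℕ} (hk : 1 ≤ k)
    (A : NOp ι k) :
    HasSum (fun j : ℕ => (t : ℂ) ^ j / j.factorial * S.limitTerm τ j k A)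
      (S.limitFun τ t k A) := by
  have hgeom : Summable fun j : ℕ => (2 : ℝ) ^ k * (2 * 4 * t) ^ j :=
    (summable_geometric_of_lt_one (by positivity) (by linarith)).mul_left _
  have hsum : Summable fun j : ℕ => ((t : ℂ) ^ j / (j.factorial : ℂ)) • S.limitTerm τ j k :=
    hgeom.of_norm_bounded fun j =>
      norm_pow_div_factorial_smul_le (by norm_num) ht hk (S.norm_limitTerm_le hτ j hk)
  exact hsum.hasSum.mapL (ContinuousLinearMap.apply ℂ ℂ A)

theorem isProductFamily_limitFun {τ : (k : ℕ) → OpDual (L2 (Fin k → ι))}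
    (hτ : ∀ k, 1 ≤ k → ‖τ k‖ ≤ 1) (hprod : IsProductFamily τ) {t : ℝ} (ht : 0 ≤ t)
    (ht' : 8 * t < 1) : IsProductFamily (S.limitFun τ t) := by
  intro k l n f g hk hl hfg A B
  have hn : 1 ≤ n := hk.trans (by simpa using Fintype.card_le_of_embedding f)
  have hA := S.hasSum_limitFun_apply hτ ht ht' hk A
  have hB := S.hasSum_limitFun_apply hτ ht ht' hl B
  rw [← (S.hasSum_limitFun_apply hτ ht ht' hn _).tsum_eq, ← hA.tsum_eq, ← hB.tsum_eq,
    tsum_pow_div_factorial_mul hA.summable hB.summable]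
  exact tsum_congr fun j => by rw [S.limitTerm_mul hprod j f g hk hl hfg]

theorem tendsto_reduced_comp_semigroup {φ : (N : ℕ) → OpDual (L2 (Fin N → ι))}
    {τ : (k : ℕ) → OpDual (L2 (Fin k → ι))} (hφ : ∀ N, 2 ≤ N → IsSymmFun (φ N))
    (hφ1 : ∀ N, 2 ≤ N → ‖φ N‖ ≤ 1)
    (hτ : ∀ k, 1 ≤ k → Tendsto (fun N => reduced k (φ N)) atTop (𝓝 (τ k)))
    {t : ℝ} (ht : 0 ≤ t) (ht' : 16 * t < 1) (k : ℕ) (hk : 1 ≤ k) :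
    Tendsto (fun N => reduced k (φ N ∘L S.semigroup N t)) atTop (𝓝 (S.limitFun τ t k)) := by
  have hgeom : Summable fun j : ℕ => (2 : ℝ) ^ k * (2 * 8 * t) ^ j :=
    (summable_geometric_of_lt_one (by positivity) (by linarith)).mul_left _
  have hbound : ∀ᶠ N in atTop, ∀ j : ℕ, ‖((t : ℂ) ^ j / (j.factorial : ℂ)) •
      reduced k (φ N ∘L (S.generator N ^ j))‖ ≤ 2 ^ k * (2 * 8 * t) ^ j := by
    filter_upwards [eventually_ge_atTop 2] with N hN j
    exact norm_pow_div_factorial_smul_le (by norm_num) ht hk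
      (S.norm_reduced_comp_generator_pow_le hN (hφ N hN) (hφ1 N hN) j k)
  have hterm : ∀ j : ℕ, Tendsto (fun N => ((t : ℂ) ^ j / (j.factorial : ℂ)) •
      reduced k (φ N ∘L (S.generator N ^ j))) atTop
      (𝓝 (((t : ℂ) ^ j / (j.factorial : ℂ)) • S.limitTerm τ j k)) := fun j =>
    (S.tendsto_reduced_comp_generator_pow hφ hτ j k hk).const_smul _
  refine (tendsto_tsum_of_dominated_convergence hgeom hterm hbound).congr' ?_
  filter_upwards [eventually_ge_atTop k] with N hN
  let P : OpDual (L2 (Fin N → ι)) →L[ℂ] OpDual (L2 (Fin k → ι)) :=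
    (ContinuousLinearMap.compL ℂ (NOp ι k) (NOp ι N) ℂ).flip (embed (Fin.castLEEmb hN))
  have hP : ∀ ω, reduced k ω = P ω := reduced_of_le hN
  rw [hP, ← ((S.hasSum_comp_semigroup t (φ N)).mapL P).tsum_eq]
  exact tsum_congr fun j => by rw [hP, map_smul]

end CollisionSpec

/-! ### Normal states -/

section NormalState

open scoped ComplexOrder

variable {E : Type*} [NormedAddCommGroup E] [InnerProductSpace ℂ E]

/-- Normal states: positive, normalised functionals on `B(E)` that lie in the predual. They are
the functionals `A ↦ Tr (ρ A)` given by density matrices `ρ`. -/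
structure IsNormalState (ω : OpDual E) : Prop where
  mem_predual : ω ∈ predual E
  nonneg {A : E →L[ℂ] E} : A.IsPositive → 0 ≤ ω A
  map_one : ω 1 = 1

theorem isClosed_isNormalState : IsClosed {ω : OpDual E | IsNormalState ω} := by
  have happly : ∀ A : E →L[ℂ] E, Continuous fun ω : OpDual E => ω A := fun A => by fun_prop
  have hset : {ω : OpDual E | IsNormalState ω} =
      ((predual E : Set (OpDual E)) ∩
        ⋂ A : {A : E →L[ℂ] E // A.IsPositive}, {ω | 0 ≤ ω A}) ∩ {ω | ω 1 = 1} := by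
    ext ω
    exact ⟨fun h => ⟨⟨h.1, Set.mem_iInter.2 fun A => h.2 A.2⟩, h.3⟩,
      fun h => ⟨h.1.1, fun hA => Set.mem_iInter.1 h.1.2 ⟨_, hA⟩, h.2⟩⟩
  rw [hset]
  have hpos : IsClosed (⋂ A : {A : E →L[ℂ] E // A.IsPositive}, {ω : OpDual E | 0 ≤ ω A}) :=
    isClosed_iInter fun A => isClosed_le continuous_const (happly A)
  exact (isClosed_predual.inter hpos).inter (isClosed_eq (happly 1) continuous_const)

variable [CompleteSpace E]

theorem exists_eq_star_mul_self {A : E →L[ℂ] E} (hA : A.IsPositive) : ∃ B, A = star B * B :=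
  CStarAlgebra.nonneg_iff_eq_star_mul_self.1 ((ContinuousLinearMap.nonneg_iff_isPositive A).2 hA)

theorem nonneg_of_isPositive_dens {ω : OpDual E} (hω : ω ∈ predual E) (hp : (dens ω).IsPositive)
    {A : E →L[ℂ] E} (hA : A.IsPositive) : 0 ≤ ω A := by
  obtain ⟨B, rfl⟩ := exists_eq_star_mul_self hA
  obtain ⟨w, b, -⟩ := exists_hilbertBasis ℂ E
  obtain ⟨hmem, hdens⟩ := mulLeftRight_mem_transposePairs (star B) B
  have htrace := hasSum_trace_dens b (hmem ω hω)
  have hconj : (B * dens ω * star B).IsPositive := hp.conj_adjoint B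
  rw [hdens, ContinuousLinearMap.comp_apply, ContinuousLinearMap.mulLeftRight_apply,
    ContinuousLinearMap.mulLeftRight_apply, mul_one] at htrace
  exact htrace.nonneg fun i => hconj.inner_nonneg_right (b i)

variable {X : Type*} (b : HilbertBasis X ℂ E)

theorem exists_isNormalState {ρ : E →L[ℂ] E} (hρ : IsDensityMatrix b ρ) :
    ∃ ω, IsNormalState ω ∧ dens ω = ρ ∧ ‖ω‖ ≤ 1 := by
  obtain ⟨ω, hω, rfl, hnorm⟩ := exists_mem_predual_of_isPositive b hρ.1
    (RCLike.hasSum_re ℂ hρ.2)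
  exact ⟨ω, ⟨hω, nonneg_of_isPositive_dens hω hρ.1, (hasSum_trace_dens b hω).unique hρ.2⟩, rfl,
    by simpa using hnorm⟩

namespace IsNormalState

variable {ω : OpDual E} (hω : IsNormalState ω)
include hω

theorem isPositive_dens : (dens ω).IsPositive := by
  refine (ContinuousLinearMap.isPositive_iff_complex _).2 fun x => ?_
  obtain ⟨hre, him⟩ := Complex.nonneg_iff.1
    (hω.nonneg (InnerProductSpace.isPositive_rankOne_self x))
  rw [← inner_dens] at hre him
  rw [← inner_conj_symm, RCLike.conj_re]
  exact ⟨Complex.ext rfl (by simpa using! him.symm), hre⟩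

theorem isDensityMatrix_dens : IsDensityMatrix b (dens ω) :=
  ⟨hω.isPositive_dens, hω.map_one ▸ hasSum_trace_dens b hω.mem_predual⟩

theorem norm_le_one : ‖ω‖ ≤ 1 := by
  obtain ⟨w, b, -⟩ := exists_hilbertBasis ℂ E
  obtain ⟨η, hη, hdens, hnorm⟩ := exists_isNormalState b (hω.isDensityMatrix_dens b)
  rwa [← dens_injOn_predual hη.mem_predual hω.mem_predual hdens]

end IsNormalState

end NormalState

section States

variable {ι V W : Type*}

theorem isPositive_embed (f : V ↪ W) {A : Op (V → ι)} (hA : A.IsPositive) :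
    (embed f A).IsPositive := by
  obtain ⟨B, rfl⟩ := exists_eq_star_mul_self hA
  rw [embed_mul, embed_star]
  exact ContinuousLinearMap.isPositive_adjoint_comp_self (embed f B)

theorem IsNormalState.comp_embed {ω : OpDual (L2 (W → ι))} (hω : IsNormalState ω) (f : V ↪ W) :
    IsNormalState (ω ∘L embed f) where
  mem_predual := comp_embed_mem_predual f hω.mem_predual
  nonneg hA := hω.nonneg (isPositive_embed f hA)
  map_one := by rw [ContinuousLinearMap.comp_apply, embed_one, hω.map_one]

theorem IsNormalState.reduced {k N : ℕ} {ω : OpDual (L2 (Fin N → ι))} (hω : IsNormalState ω)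
    (hk : k ≤ N) : IsNormalState (reduced k ω) := by
  rw [reduced_of_le hk]
  exact hω.comp_embed _

theorem embed_perm_matUnit (π : Equiv.Perm V) (α β : V → ι) :
    embed π.toEmbedding (matUnit α β) = matUnit (α ∘ π.symm) (β ∘ π.symm) := by
  classical
  refine entry_ext fun x y => ?_
  simp [entry_embed, entry_matUnit, Equiv.eq_comp_symm]

theorem dens_comp_embed_perm (π : Equiv.Perm V) (ω : OpDual (L2 (V → ι))) :
    dens (ω ∘L embed π.toEmbedding) = embed π.symm.toEmbedding (dens ω) := by
  refine entry_ext fun x y => ?_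
  simp [entry_dens, entry_embed, embed_perm_matUnit]

theorem isSymmFun_iff {N : ℕ} {ω : OpDual (L2 (Fin N → ι))}
    (hω : ω ∈ predual (L2 (Fin N → ι))) :
    IsSymmFun ω ↔ ∀ π : Equiv.Perm (Fin N), permOp ι π * dens ω * star (permOp ι π) = dens ω := by
  simp only [permOp_conj, ← dens_comp_embed_perm]
  exact forall_congr' fun π =>
    (dens_injOn_predual.eq_iff (comp_embed_mem_predual _ hω) hω).symm

theorem IsNormalState.isSymmDensityMatrix_dens {N : ℕ} {ω : OpDual (L2 (Fin N → ι))}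
    (hω : IsNormalState ω) (hsymm : IsSymmFun ω) : IsSymmDensityMatrix (dens ω) :=
  ⟨hω.isDensityMatrix_dens _, (isSymmFun_iff hω.mem_predual).1 hsymm⟩

theorem exists_isNormalState_isSymmFun {N : ℕ} {A : NOp ι N} (hA : IsSymmDensityMatrix A) :
    ∃ ω, IsNormalState ω ∧ IsSymmFun ω ∧ dens ω = A := by
  obtain ⟨ω, hω, rfl, -⟩ := exists_isNormalState _ hA.1
  exact ⟨ω, hω, (isSymmFun_iff hω.mem_predual).2 hA.2, rfl⟩

theorem marginal_dens_eq {k m : ℕ} {ω : OpDual (L2 (Fin (k + m) → ι))}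
    (hω : ω ∈ predual (L2 (Fin (k + m) → ι))) :
    marginal k m (dens ω) = dens (reduced k ω) := by
  rw [marginal_dens k m hω, reduced_of_le (Nat.le_add_right k m)]
  rfl

theorem CollisionSpec.isNormalState_comp_semigroup {H : Type*} [NormedAddCommGroup H]
    [InnerProductSpace ℂ H] {b : HilbertBasis ι ℂ H} {h : H →ₗ.[ℂ] H}
    {C : Type*} [MetricSpace C] [CompactSpace C] [MeasurableSpace C] [BorelSpace C]
    (S : CollisionSpec b h C) {N : ℕ} (hN : 2 ≤ N) {ω : OpDual (L2 (Fin N → ι))}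
    (hω : IsNormalState ω) {t : ℝ} (ht : 0 ≤ t) : IsNormalState (ω ∘L S.semigroup N t) where
  mem_predual := S.comp_semigroup_mem_predual hω.mem_predual t
  nonneg hA := hω.nonneg (S.isPositive_semigroup hA ht)
  map_one := by rw [ContinuousLinearMap.comp_apply, S.semigroup_one hN, hω.map_one]

end States

/-! ### Chaotic sequences of normal states -/

section ChaoticStates

variable {ι : Type*}

theorem tendsto_traceNorm_marginal_sub {k : ℕ} {φ : (N : ℕ) → OpDual (L2 (Fin N → ι))}
    (hφ : ∀ N, 2 ≤ N → IsNormalState (φ N)) {τ : OpDual (L2 (Fin k → ι))}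
    (hτ : IsNormalState τ) (hlim : Tendsto (fun N => reduced k (φ N)) atTop (𝓝 τ)) :
    Tendsto (fun m => traceNorm (stdBasis _) (marginal k m (dens (φ (k + m))) - dens τ))
      atTop (𝓝 0) := by
  have hnorm := (ENNReal.tendsto_ofReal (tendsto_iff_norm_sub_tendsto_zero.1 hlim)).comp
    (tendsto_add_atTop_nat k)
  rw [ENNReal.ofReal_zero] at hnorm
  refine tendsto_of_tendsto_of_tendsto_of_le_of_le' tendsto_const_nhds hnorm
    (Eventually.of_forall fun m => zero_le) ?_
  filter_upwards [eventually_ge_atTop 2] with m hm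
  have hN := hφ (k + m) (by omega)
  have hk := hN.reduced (Nat.le_add_right k m)
  rw [Function.comp_apply, Nat.add_comm m k, marginal_dens_eq hN.mem_predual, ← map_sub]
  refine traceNorm_dens_le _ (sub_mem hk.mem_predual hτ.mem_predual) ?_
  rw [map_sub]
  exact hk.isPositive_dens.isSelfAdjoint.sub hτ.isPositive_dens.isSelfAdjoint

theorem exists_tendsto_reduced {k : ℕ} {φ : (N : ℕ) → OpDual (L2 (Fin N → ι))}
    (hφ : ∀ N, 2 ≤ N → IsNormalState (φ N)) {R : NOp ι k} (hR : IsSelfAdjoint R)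
    (hlim : Tendsto (fun m => traceNorm (stdBasis _) (marginal k m (dens (φ (k + m))) - R))
      atTop (𝓝 0)) :
    ∃ τ, IsNormalState τ ∧ dens τ = R ∧ Tendsto (fun N => reduced k (φ N)) atTop (𝓝 τ) := by
  set d := fun m => traceNorm (stdBasis _) (marginal k m (dens (φ (k + m))) - R) with hd
  have hreduced : ∀ m, 2 ≤ k + m → IsNormalState (reduced k (φ (k + m))) := fun m hm =>
    (hφ _ hm).reduced (Nat.le_add_right k m)
  have hdiff : ∀ᶠ m in atTop, ∃ τ ∈ predual (L2 (Fin k → ι)), dens τ = R ∧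
      ‖reduced k (φ (k + m)) - τ‖ ≤ (d m).toReal := by
    filter_upwards [eventually_ge_atTop 2, hlim.eventually (gt_mem_nhds ENNReal.zero_lt_top)]
      with m hm hfin
    have hN : 2 ≤ k + m := by omega
    simp only [hd, marginal_dens_eq (hφ _ hN).mem_predual] at hfin ⊢
    obtain ⟨ω, hω, hdens, hnorm⟩ := exists_mem_predual_of_traceNorm_ne_top _
      ((hreduced m hN).isPositive_dens.isSelfAdjoint.sub hR) hfin.ne
    refine ⟨reduced k (φ (k + m)) - ω, sub_mem (hreduced m hN).mem_predual hω, ?_, ?_⟩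
    · rw [map_sub, hdens, sub_sub_cancel]
    · rwa [sub_sub_cancel]
  obtain ⟨m₀, τ, hτ, hdτ, -⟩ := hdiff.exists
  have htendsto : Tendsto (fun m => reduced k (φ (k + m))) atTop (𝓝 τ) := by
    rw [tendsto_iff_norm_sub_tendsto_zero]
    refine squeeze_zero' (Eventually.of_forall fun m => norm_nonneg _) ?_
      ((ENNReal.tendsto_toReal ENNReal.zero_ne_top).comp hlim)
    filter_upwards [hdiff] with m ⟨τ', hτ', hdτ', hle⟩
    rwa [dens_injOn_predual hτ' hτ (hdτ'.trans hdτ.symm)] at hle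
  refine ⟨τ, isClosed_isNormalState.mem_of_tendsto htendsto ?_, hdτ,
    (tendsto_add_atTop_iff_nat k).1 (htendsto.congr fun m => by rw [Nat.add_comm])⟩
  filter_upwards [eventually_ge_atTop 2] with m hm
  exact hreduced m (by omega)

/-- Chaoticity in terms of functionals: the symmetric normal states `φ N`, `N ≥ 2`, have marginals
that converge in norm to a product family `τ`. This corresponds to `IsChaotic` for the densities
`dens (φ N)`. -/
structure IsChaoticStates (φ τ : (N : ℕ) → OpDual (L2 (Fin N → ι))) : Prop where
  isNormalState : ∀ N, 2 ≤ N → IsNormalState (φ N)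
  isSymmFun : ∀ N, 2 ≤ N → IsSymmFun (φ N)
  tendsto : ∀ k, 1 ≤ k → Tendsto (fun N => reduced k (φ N)) atTop (𝓝 (τ k))
  isProductFamily : IsProductFamily τ

theorem IsChaoticStates.isNormalState_limit {φ τ : (N : ℕ) → OpDual (L2 (Fin N → ι))}
    (hφ : IsChaoticStates φ τ) {k : ℕ} (hk : 1 ≤ k) : IsNormalState (τ k) := by
  refine isClosed_isNormalState.mem_of_tendsto (hφ.tendsto k hk) ?_
  filter_upwards [eventually_ge_atTop (max 2 k)] with N hN
  exact (hφ.isNormalState N (by omega)).reduced (by omega)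

end ChaoticStates

section TensorPower

variable {H : Type*} [NormedAddCommGroup H] [InnerProductSpace ℂ H] {ι : Type*}
  {b : HilbertBasis ι ℂ H} {ρ : H →L[ℂ] H}

theorem isSelfAdjoint_tensorPow [CompleteSpace H] (hρ : IsSelfAdjoint ρ) (k : ℕ) :
    IsSelfAdjoint (tensorPow b ρ k) := by
  have hconj : ∀ x y : H, star ⟪x, ρ y⟫_ℂ = ⟪y, ρ x⟫_ℂ := fun x y => by
    rw [← ContinuousLinearMap.adjoint_inner_left, ContinuousLinearMap.isSelfAdjoint_iff'.1 hρ]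
    exact inner_conj_symm _ _
  refine entry_ext fun α β => ?_
  simp only [entry_star, entry_tensorPow, star_prod, hconj]

theorem apply_embed_mul_embed {k l : ℕ} {ω : OpDual (L2 (Fin (k + l) → ι))}
    {σ : OpDual (L2 (Fin k → ι))} {τ : OpDual (L2 (Fin l → ι))} (hω : ω ∈ predual _)
    (hσ : σ ∈ predual _) (hτ : τ ∈ predual _)
    (h : ∀ α β γ δ, ω (matUnit (Fin.append α γ) (Fin.append β δ)) =
      σ (matUnit α β) * τ (matUnit γ δ)) (A : NOp ι k) (B : NOp ι l) :
    ω (embed (Fin.castAddEmb l) A * embed (Fin.natAddEmb k) B) = σ A * τ B := by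
  have hmem : ∀ U V, ω ∘L ContinuousLinearMap.mulLeftRight ℂ _ U V ∈ predual _ := fun U V =>
    (mulLeftRight_mem_transposePairs U V).1 ω hω
  have hleft : ∀ A γ δ, ω (embed (Fin.castAddEmb l) A * embed (Fin.natAddEmb k) (matUnit γ δ)) =
      σ A * τ (matUnit γ δ) := fun A γ δ => by
    have heq := eq_of_apply_matUnit
      (comp_embed_mem_predual (Fin.castAddEmb l) (hmem 1 (embed (Fin.natAddEmb k) (matUnit γ δ))))
      (Submodule.smul_mem _ (τ (matUnit γ δ)) hσ)
      fun α β => by simpa [embed_matUnit_mul, mul_comm] using h α β γ δ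
    simpa [mul_comm] using DFunLike.congr_fun heq A
  have heq := eq_of_apply_matUnit
    (comp_embed_mem_predual (Fin.natAddEmb k) (hmem (embed (Fin.castAddEmb l) A) 1))
    (Submodule.smul_mem _ (σ A) hτ) fun γ δ => by simpa using hleft A γ δ
  simpa using DFunLike.congr_fun heq B

theorem isProductFamily_of_dens_eq_tensorPow {τ : (k : ℕ) → OpDual (L2 (Fin k → ι))}
    (hτ : ∀ k, 1 ≤ k → τ k ∈ predual (L2 (Fin k → ι)))
    (hdens : ∀ k, 1 ≤ k → dens (τ k) = tensorPow b ρ k)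
    (hcons : ∀ {k n : ℕ} (e : Fin k ↪ Fin n), 1 ≤ k → τ n ∘L embed e = τ k) :
    IsProductFamily τ := by
  intro k l n f g hk hl hfg A B
  have hkl : 1 ≤ k + l := by omega
  let e : Fin (k + l) ↪ Fin n := ⟨Fin.append f g, Fin.append_injective_iff.2
    ⟨f.injective, g.injective, Set.disjoint_range_iff.1 hfg⟩⟩
  have hf : f = (Fin.castAddEmb l).trans e := by
    ext1 v; exact (Fin.append_left (f : Fin k → Fin n) g v).symm
  have hg : g = (Fin.natAddEmb k).trans e := by
    ext1 v; exact (Fin.append_right (f : Fin k → Fin n) g v).symm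
  have hentry : ∀ q, 1 ≤ q → ∀ α β, τ q (matUnit α β) = ∏ i, ⟪b (β i), ρ (b (α i))⟫_ℂ :=
    fun q hq α β => by rw [← entry_dens, hdens q hq, entry_tensorPow]
  rw [hf, hg, embed_trans, embed_trans, ← embed_mul, ← ContinuousLinearMap.comp_apply,
    hcons e hkl]
  refine apply_embed_mul_embed (hτ _ hkl) (hτ k hk) (hτ l hl) (fun α β γ δ => ?_) A B
  rw [hentry _ hkl, hentry k hk, hentry l hl, Fin.prod_univ_add]
  simp only [Fin.append_left, Fin.append_right]

theorem dens_eq_tensorPow {τ : (k : ℕ) → OpDual (L2 (Fin k → ι))} (hτ : IsProductFamily τ)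
    (hρ : ∀ α β : Fin 1 → ι, τ 1 (matUnit α β) = ⟪b (β 0), ρ (b (α 0))⟫_ℂ)
    {k : ℕ} (hk : 1 ≤ k) : dens (τ k) = tensorPow b ρ k := by
  refine entry_ext fun β α => ?_
  rw [entry_dens, entry_tensorPow]
  induction k, hk using Nat.le_induction with
  | base => rw [hρ, Fin.prod_univ_one]
  | succ k hk ih =>
    have hsplit := embed_matUnit_mul (l := 1) (fun i => α (Fin.castAdd 1 i))
      (fun i => β (Fin.castAdd 1 i)) (fun i => α (Fin.natAdd k i)) (fun i => β (Fin.natAdd k i))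
    rw [Fin.append_castAdd_natAdd, Fin.append_castAdd_natAdd] at hsplit
    rw [← hsplit, hτ k 1 (k + 1) _ _ hk le_rfl (disjoint_range_castAddEmb_natAddEmb k 1), ih, hρ,
      Fin.prod_univ_add, Fin.prod_univ_one]

variable (b) in
/-- The operator on the one-particle space `H` that corresponds to an operator on `ℓ²(ι ^ 1)`. -/
def oneParticleOp (A : NOp ι 1) : H →L[ℂ] H :=
  ((coords b).symm : L2 ι →L[ℂ] H) ∘L
    transport (Equiv.funUnique (Fin 1) ι).symm A ∘L (coords b : H →L[ℂ] L2 ι)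

theorem inner_oneParticleOp (A : NOp ι 1) (α β : Fin 1 → ι) :
    ⟪b (α 0), oneParticleOp b A (b (β 0))⟫_ℂ = entry A α β := by
  classical
  have hcoords : ∀ i, coords b (b i) = stdBasis ι i := fun i =>
    (b.repr_self i).trans ((stdBasis ι).repr_self i).symm
  have hsymm : ∀ α : Fin 1 → ι, (Equiv.funUnique (Fin 1) ι).symm (α 0) = α :=
    (Equiv.funUnique (Fin 1) ι).symm_apply_apply
  rw [← (coords b).inner_map_map, oneParticleOp]
  simp only [ContinuousLinearMap.comp_apply, LinearIsometryEquiv.coe_coe'',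
    LinearIsometryEquiv.apply_symm_apply, hcoords]
  rw [← entry, entry_transport, hsymm, hsymm]

theorem isDensityMatrix_oneParticleOp [CompleteSpace H] {A : NOp ι 1}
    (hA : IsDensityMatrix (stdBasis _) A) : IsDensityMatrix b (oneParticleOp b A) := by
  let W : L2 (Fin 1 → ι) →L[ℂ] H := ((coords b).symm : L2 ι →L[ℂ] H) ∘L
    (reindex (Equiv.funUnique (Fin 1) ι).symm : L2 (Fin 1 → ι) →L[ℂ] L2 ι)
  have hadj : W.adjoint =
      ((reindex (Equiv.funUnique (Fin 1) ι).symm).symm : L2 ι →L[ℂ] L2 (Fin 1 → ι)) ∘L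
        (coords b : H →L[ℂ] L2 ι) := by
    rw [ContinuousLinearMap.adjoint_comp, LinearIsometryEquiv.adjoint_eq_symm,
      LinearIsometryEquiv.adjoint_eq_symm, LinearIsometryEquiv.symm_symm]
  refine ⟨?_, ?_⟩
  · have hpos := hA.1.conj_adjoint W
    rwa [hadj] at hpos
  · rw [← (Equiv.funUnique (Fin 1) ι).hasSum_iff]
    exact hA.2.congr_fun fun α => inner_oneParticleOp A α α

end TensorPower

section Chaos

variable {H : Type*} [NormedAddCommGroup H] [InnerProductSpace ℂ H] {ι : Type*}
  {b : HilbertBasis ι ℂ H}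

theorem comp_embed_eq_of_tendsto {φ τ : (N : ℕ) → OpDual (L2 (Fin N → ι))}
    (hsymm : ∀ N, 2 ≤ N → IsSymmFun (φ N))
    (hlim : ∀ k, 1 ≤ k → Tendsto (fun N => reduced k (φ N)) atTop (𝓝 (τ k)))
    {k n : ℕ} (e : Fin k ↪ Fin n) (hk : 1 ≤ k) : τ n ∘L embed e = τ k := by
  have hkn : k ≤ n := by simpa using Fintype.card_le_of_embedding e
  have hcomp : Tendsto (fun N => reduced n (φ N) ∘L embed e) atTop (𝓝 (τ n ∘L embed e)) :=
    ((continuous_id.clm_comp continuous_const).tendsto (τ n)).comp (hlim n (hk.trans hkn))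
  refine tendsto_nhds_unique (hcomp.congr' ?_) (hlim k hk)
  filter_upwards [eventually_ge_atTop (max 2 n)] with N hN
  exact (hsymm N (by omega)).reduced_comp_embed (by omega) e

theorem IsChaotic.congr [CompleteSpace H] {ρ : H →L[ℂ] H} {ϱ ϱ' : (N : ℕ) → NOp ι N}
    (hc : IsChaotic b ρ ϱ) (heq : ∀ N, 2 ≤ N → ϱ N = ϱ' N) : IsChaotic b ρ ϱ' where
  density := hc.density
  symm_density N hN := heq N hN ▸ hc.symm_density N hN
  tendsto k hk := by
    refine (hc.tendsto k hk).congr' ?_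
    filter_upwards [eventually_ge_atTop 2] with m hm
    rw [heq (k + m) (by omega)]

theorem IsChaotic.exists_isChaoticStates [CompleteSpace H] {ρ : H →L[ℂ] H}
    {ϱ : (N : ℕ) → NOp ι N} (hc : IsChaotic b ρ ϱ) :
    ∃ φ τ, IsChaoticStates φ τ ∧ ∀ N, 2 ≤ N → dens (φ N) = ϱ N := by
  choose! φ hφ hsymm hdens using fun N (hN : 2 ≤ N) =>
    exists_isNormalState_isSymmFun (hc.symm_density N hN)
  have hmarginal : ∀ k, 1 ≤ k → Tendsto (fun m => traceNorm (stdBasis _)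
      (marginal k m (dens (φ (k + m))) - tensorPow b ρ k)) atTop (𝓝 0) :=
    (hc.congr fun N hN => (hdens N hN).symm).tendsto
  choose! τ hτ hdτ hlim using fun k (hk : 1 ≤ k) => exists_tendsto_reduced hφ
    (isSelfAdjoint_tensorPow hc.density.1.isSelfAdjoint k) (hmarginal k hk)
  exact ⟨φ, τ, ⟨hφ, hsymm, hlim, isProductFamily_of_dens_eq_tensorPow
    (fun k hk => (hτ k hk).mem_predual) hdτ (comp_embed_eq_of_tendsto hsymm hlim)⟩, hdens⟩

theorem IsChaoticStates.exists_isChaotic [CompleteSpace H]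
    {φ τ : (N : ℕ) → OpDual (L2 (Fin N → ι))} (hφ : IsChaoticStates φ τ) :
    ∃ ρ, IsChaotic b ρ fun N => dens (φ N) := by
  refine ⟨oneParticleOp b (dens (τ 1)), ?_, fun N hN => ?_, fun k hk => ?_⟩
  · exact isDensityMatrix_oneParticleOp ((hφ.isNormalState_limit le_rfl).isDensityMatrix_dens _)
  · exact (hφ.isNormalState N hN).isSymmDensityMatrix_dens (hφ.isSymmFun N hN)
  · rw [← dens_eq_tensorPow hφ.isProductFamily
      (fun α β => by rw [inner_oneParticleOp, entry_dens]) hk]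
    exact tendsto_traceNorm_marginal_sub hφ.isNormalState (hφ.isNormalState_limit hk)
      (hφ.tendsto k hk)

namespace CollisionSpec

variable {h : H →ₗ.[ℂ] H} {C : Type*} [MetricSpace C] [CompactSpace C] [MeasurableSpace C]
  [BorelSpace C] (S : CollisionSpec b h C)

theorem isChaoticStates_comp_semigroup {φ τ : (N : ℕ) → OpDual (L2 (Fin N → ι))}
    (hφ : IsChaoticStates φ τ) {t : ℝ} (ht : 0 ≤ t) (ht' : 16 * t < 1) :
    IsChaoticStates (fun N => φ N ∘L S.semigroup N t) (S.limitFun τ t) where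
  isNormalState N hN := S.isNormalState_comp_semigroup hN (hφ.isNormalState N hN) ht
  isSymmFun N hN := (hφ.isSymmFun N hN).comp_of_commute fun π =>
    S.commute_embed_perm_semigroup hN π t
  tendsto := S.tendsto_reduced_comp_semigroup hφ.isSymmFun
    (fun N hN => (hφ.isNormalState N hN).norm_le_one) hφ.tendsto ht ht'
  isProductFamily := S.isProductFamily_limitFun
    (fun _ hk => (hφ.isNormalState_limit hk).norm_le_one) hφ.isProductFamily ht (by linarith)

/- The expansion converges for short times only, but the bound `16 * t < 1` does not depend on the
initial data, so that the short-time result can be iterated. -/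
theorem exists_isChaoticStates_comp_semigroup {φ τ : (N : ℕ) → OpDual (L2 (Fin N → ι))}
    (hφ : IsChaoticStates φ τ) {t : ℝ} (ht : 0 ≤ t) :
    ∃ τ', IsChaoticStates (fun N => φ N ∘L S.semigroup N t) τ' := by
  obtain ⟨n, hn⟩ := exists_nat_gt (16 * t)
  have hn0 : (0 : ℝ) < n := by linarith
  have hstep : 16 * (t / n) < 1 := by rwa [← mul_div_assoc, div_lt_one hn0]
  have hiter : ∀ m : ℕ, ∃ τ', IsChaoticStates (fun N => φ N ∘L S.semigroup N (m * (t / n))) τ' := by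
    intro m
    induction m with
    | zero =>
      refine ⟨τ, ?_⟩
      convert hφ using 2 with N
      ext A
      simp [semigroup_zero]
    | succ m ih =>
      obtain ⟨τ', hτ'⟩ := ih
      refine ⟨S.limitFun τ' (t / n), ?_⟩
      convert S.isChaoticStates_comp_semigroup hτ' (by positivity) hstep using 2 with N
      ext A
      simp [add_mul, semigroup_add]
  simpa [mul_div_cancel₀ t hn0.ne'] using hiter n

theorem exists_isChaotic_semigroup [CompleteSpace H] {ρ : H →L[ℂ] H} {ϱ : (N : ℕ) → NOp ι N}
    (hc : IsChaotic b ρ ϱ) {t : ℝ} (ht : 0 ≤ t) :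
    ∃ ρt, IsChaotic b ρt fun N => S.semigroup N t (ϱ N) := by
  obtain ⟨φ, τ, hφ, hdens⟩ := hc.exists_isChaoticStates
  obtain ⟨τ', hτ'⟩ := S.exists_isChaoticStates_comp_semigroup hφ ht
  obtain ⟨ρt, hρt⟩ := hτ'.exists_isChaotic (b := b)
  exact ⟨ρt, hρt.congr fun N hN => by rw [dens_comp_semigroup, hdens N hN]⟩

end CollisionSpec

end Chaos

end QKac

end

theorem theorem3p1_general
    {H : Type*} [NormedAddCommGroup H] [InnerProductSpace ℂ H] [CompleteSpace H]
    {ι : Type*} (b : HilbertBasis ι ℂ H) (h : H →ₗ.[ℂ] H)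
    {C : Type*} [MetricSpace C] [CompactSpace C] [MeasurableSpace C] [BorelSpace C]
    (S : CollisionSpec b h C) (ρ : H →L[ℂ] H) (ϱ : (N : ℕ) → NOp ι N)
    (h_chaotic : IsChaotic b ρ ϱ) (t : ℝ) (ht : 0 ≤ t) :
    ∃ ρt : H →L[ℂ] H, IsDensityMatrix b ρt ∧
      Tendsto (fun m => traceNorm (stdBasis _)
        (marginal 1 m (S.semigroup (1 + m) t (ϱ (1 + m))) - tensorPow b ρt 1)) atTop (𝓝 0) ∧
      IsChaotic b ρt (fun N => S.semigroup N t (ϱ N)) := by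
  obtain ⟨ρt, hρt⟩ := S.exists_isChaotic_semigroup h_chaotic ht
  exact ⟨ρt, hρt.density, hρt.tendsto 1 le_rfl, hρt⟩

theorem theorem3p1
    {H : Type*} [NormedAddCommGroup H] [InnerProductSpace ℂ H] [CompleteSpace H]
    [TopologicalSpace.SeparableSpace H]
    {ι : Type*} (b : HilbertBasis ι ℂ H)
    (h : H →ₗ.[ℂ] H) (h_sa : IsSelfAdjoint h) (h_compact : HasCompactResolvent h)
    {C : Type*} [MetricSpace C] [CompactSpace C] [MeasurableSpace C] [BorelSpace C]
    (S : CollisionSpec b h C) (h_ergodic : S.IsErgodic)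
    (ρ : H →L[ℂ] H) (ϱ : (N : ℕ) → NOp ι N) (h_chaotic : IsChaotic b ρ ϱ)
    (t : ℝ) (ht : 0 ≤ t) :
    ∃ ρt : H →L[ℂ] H, IsDensityMatrix b ρt ∧
      Tendsto (fun m => traceNorm (stdBasis _)
        (marginal 1 m (S.semigroup (1 + m) t (ϱ (1 + m))) - tensorPow b ρt 1)) atTop (𝓝 0) ∧
      IsChaotic b ρt (fun N => S.semigroup N t (ϱ N)) :=
  theorem3p1_general b h S ρ ϱ h_chaotic t ht
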